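/- Let $\gamma,\eta,\kappa,\beta$ be real numbers with $\eta\ge 0$, $\kappa\ge 0$, $\beta\in(0,1)$ and $\gamma>\eta^2$. Let $W_2^k(0,1)$ be the complex Sobolev space of order $k$ over $L_2(0,1)$, and for $k\ge 1$ let $\hat W_2^k(0,1)=\{w\in W_2^k(0,1): w(0)=0\}$. Let $\mathbb X=\hat W_2^2(0,1)\times L_2(0,1)$ be the Hilbert space whose inner product induces the norm $$\|x\|=\Big[\int_0^1\big(|w''(s)|^2+(\gamma-\eta^2)|w'(s)|^2+|v(s)|^2\big)\,ds\Big]^{1/2},\qquad x=(w,v)\in\mathbb X.$$ Let $T=A+B$ in $\mathbb X$, where $$A(w,v)=\big(v,\,-w^{(4)}+(\gamma-\eta^2)w''\big),\qquad B(w,v)=\big(0,\,-2\beta\eta v'\big).$$ The domain $D(A)$ consists of all $(w,v)$ with $w\in W_2^4(0,1)\cap\hat W_2^2(0,1)$, $v\in\hat W_2^2(0,1)$, $w''(0)=0$, $w''(1)+\kappa v'(1)=0$ and $w^{(3)}(1)-(\gamma-\eta^2)w'(1)=0$; the domain of $B$ is $D(B)=\hat W_2^2(0,1)\times\hat W_2^1(0,1)\supset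 D(A)$; and $D(T)=D(A)$. Then: 1. $T$ has a compact inverse, i.e. $T:D(T)\to\mathbb X$ is bijective and $T^{-1}$ is a compact operator on $\mathbb X$. 2. If $\eta,\kappa>0$, then $T$ is maximal dissipative, i.e. $\operatorname{Re}\langle Tx,x\rangle\le 0$ for all $x\in D(T)$, $T$ has no proper dissipative extension, and $\lambda I-T$ maps $D(T)$ onto $\mathbb X$ for every $\lambda>0$. 3. If $\eta=\kappa=0$, then $T$ is skew-adjoint, i.e. $T$ is densely defined and $T^*=-T$. 4. Consequently, for all $\eta,\kappa\ge 0$, $T$ is the infinitesimal generator of a contraction $C_0$-semigroup of linear operators on $\mathbb X$. -/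

import Mathlib

open MeasureTheory Set Filter Topology
open scoped ContDiff InnerProductSpace

namespace FluidTube

noncomputable section

/-- The complex Hilbert space `L₂(0,1)`. -/
abbrev L2 : Type := Lp ℂ 2 (volume.restrict (Ioo (0 : ℝ) 1))

/-- `g ∈ L₂(0,1)` is the weak (distributional) derivative of `f ∈ L₂(0,1)`:
`∫ φ' f = - ∫ φ g` for every smooth `φ` with compact support in `(0,1)`. -/
def HasWeakDeriv (f g : L2) : Prop :=
  ∀ φ : ℝ → ℝ, ContDiff ℝ ∞ φ → HasCompactSupport φ → tsupport φ ⊆ Ioo 0 1 →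
    ∫ s in Ioo (0 : ℝ) 1, deriv φ s • f s = -∫ s in Ioo (0 : ℝ) 1, φ s • g s

theorem exists_inner_repr {φ : ℝ → ℝ} (hφ : Continuous φ) :
    ∃ p : L2, ∀ f : L2, ∫ s in Ioo (0 : ℝ) 1, φ s • f s = ⟪p, f⟫_ℂ := by
  have hm : MemLp (fun s => (φ s : ℂ)) 2 (volume.restrict (Ioo (0 : ℝ) 1)) := by
    have hc : Continuous fun s => (φ s : ℂ) := by fun_prop
    obtain ⟨C, hC⟩ := (isCompact_Icc (a := (0 : ℝ)) (b := 1)).exists_bound_of_continuousOn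
      hc.continuousOn
    refine MemLp.of_bound hc.aestronglyMeasurable C ?_
    filter_upwards [ae_restrict_mem measurableSet_Ioo] with s hs
    exact hC s (Ioo_subset_Icc_self hs)
  refine ⟨hm.toLp _, fun f => ?_⟩
  rw [L2.inner_def]
  refine integral_congr_ae ?_
  filter_upwards [hm.coeFn_toLp] with s hs
  rw [hs]
  simp [mul_comm]

theorem hasWeakDeriv_iff {f g : L2} : HasWeakDeriv f g ↔
    ∀ φ : ℝ → ℝ, ContDiff ℝ ∞ φ → HasCompactSupport φ → tsupport φ ⊆ Ioo 0 1 →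
    ∀ p q : L2, (∀ f : L2, ∫ s in Ioo (0 : ℝ) 1, deriv φ s • f s = ⟪p, f⟫_ℂ) →
      (∀ f : L2, ∫ s in Ioo (0 : ℝ) 1, φ s • f s = ⟪q, f⟫_ℂ) → ⟪p, f⟫_ℂ = -⟪q, g⟫_ℂ := by
  refine ⟨fun h φ h1 h2 h3 p q hp hq => ?_, fun h φ h1 h2 h3 => ?_⟩
  · rw [← hp, ← hq]; exact h φ h1 h2 h3
  · obtain ⟨p, hp⟩ := exists_inner_repr (h1.continuous_deriv (by simp))
    obtain ⟨q, hq⟩ := exists_inner_repr h1.continuous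
    rw [hp, hq]; exact h φ h1 h2 h3 p q hp hq

theorem HasWeakDeriv.add {f g f' g' : L2} (hf : HasWeakDeriv f f') (hg : HasWeakDeriv g g') :
    HasWeakDeriv (f + g) (f' + g') := by
  rw [hasWeakDeriv_iff] at *
  intro φ h1 h2 h3 p q hp hq
  rw [inner_add_right, inner_add_right, hf φ h1 h2 h3 p q hp hq, hg φ h1 h2 h3 p q hp hq]
  ring

theorem HasWeakDeriv.smul {f f' : L2} (c : ℂ) (hf : HasWeakDeriv f f') :
    HasWeakDeriv (c • f) (c • f') := by
  rw [hasWeakDeriv_iff] at *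
  intro φ h1 h2 h3 p q hp hq
  rw [inner_smul_right, inner_smul_right, hf φ h1 h2 h3 p q hp hq]
  ring

theorem hasWeakDeriv_zero : HasWeakDeriv 0 0 := by
  rw [hasWeakDeriv_iff]; intros; simp

theorem HasWeakDeriv.sub {f g f' g' : L2} (hf : HasWeakDeriv f f') (hg : HasWeakDeriv g g') :
    HasWeakDeriv (f - g) (f' - g') := by
  have := hf.add (hg.smul (-1))
  simpa [sub_eq_add_neg] using this

theorem isClosed_hasWeakDeriv : IsClosed {p : L2 × L2 | HasWeakDeriv p.1 p.2} := by
  simp only [hasWeakDeriv_iff, ofPred_forall]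
  refine isClosed_iInter fun φ => isClosed_iInter fun h1 => isClosed_iInter fun h2 =>
    isClosed_iInter fun h3 => isClosed_iInter fun p => isClosed_iInter fun q =>
    isClosed_iInter fun hp => isClosed_iInter fun hq => ?_
  exact isClosed_eq (by fun_prop) (by fun_prop)

theorem eq_zero_of_test {f : L2} (h : ∀ φ : ℝ → ℝ, ContDiff ℝ ∞ φ → HasCompactSupport φ →
    tsupport φ ⊆ Ioo 0 1 → ∫ s in Ioo (0 : ℝ) 1, φ s • f s = 0) : f = 0 := by
  have hi : Integrable f (volume.restrict (Ioo (0 : ℝ) 1)) :=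
    (Lp.memLp f).integrable (by norm_num)
  have := IsOpen.ae_eq_zero_of_integral_contDiff_smul_eq_zero (isOpen_Ioo (a := (0 : ℝ)) (b := 1))
    (hi.locallyIntegrable.locallyIntegrableOn _) h
  rw [Lp.eq_zero_iff_ae_eq_zero]
  filter_upwards [this, ae_restrict_mem measurableSet_Ioo] with s hs hs'
  exact hs hs'

theorem HasWeakDeriv.unique {f g g' : L2} (h : HasWeakDeriv f g) (h' : HasWeakDeriv f g') :
    g = g' := by
  have h0 := h.sub h'
  rw [sub_self] at h0
  rw [← sub_eq_zero]
  refine eq_zero_of_test fun φ h1 h2 h3 => ?_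
  have h4 := h0 φ h1 h2 h3
  obtain ⟨p, hp⟩ := exists_inner_repr (h1.continuous_deriv (by simp))
  rw [hp, inner_zero_right, eq_comm, neg_eq_zero] at h4
  exact h4

/-- The Sobolev space `W₂ᵏ(0,1)`: all weak derivatives up to order `k` exist in `L₂(0,1)`. -/
def sobolev : ℕ → Submodule ℂ L2
  | 0 => ⊤
  | k + 1 =>
    { carrier := {f | ∃ g ∈ sobolev k, HasWeakDeriv f g}
      add_mem' := by
        rintro f g ⟨f', hf, hf'⟩ ⟨g', hg, hg'⟩
        exact ⟨f' + g', add_mem hf hg, hf'.add hg'⟩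
      zero_mem' := ⟨0, zero_mem _, hasWeakDeriv_zero⟩
      smul_mem' := by
        rintro c f ⟨f', hf, hf'⟩
        exact ⟨c • f', Submodule.smul_mem _ c hf, hf'.smul c⟩ }

open Classical in
/-- The weak derivative `f'` of `f ∈ W₂¹(0,1)` (and `0` if `f` has no weak derivative
in `L₂(0,1)`). -/
def D (f : L2) : L2 := if h : ∃ g, HasWeakDeriv f g then h.choose else 0

theorem HasWeakDeriv.D_eq {f g : L2} (h : HasWeakDeriv f g) : D f = g := by
  have h' : ∃ g, HasWeakDeriv f g := ⟨g, h⟩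
  rw [D, dif_pos h']
  exact h'.choose_spec.unique h

theorem mem_sobolev_succ {k : ℕ} {f : L2} :
    f ∈ sobolev (k + 1) ↔ HasWeakDeriv f (D f) ∧ D f ∈ sobolev k := by
  constructor
  · rintro ⟨g, hg, h⟩
    rw [h.D_eq]; exact ⟨h, hg⟩
  · rintro ⟨h, hg⟩
    exact ⟨_, hg, h⟩

theorem sobolev_anti_succ (k : ℕ) : sobolev (k + 1) ≤ sobolev k := by
  induction k with
  | zero => exact fun _ _ => trivial
  | succ k ih =>
    intro f hf
    rw [mem_sobolev_succ] at hf ⊢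
    exact ⟨hf.1, ih hf.2⟩

theorem sobolev_anti {j k : ℕ} (h : j ≤ k) : sobolev k ≤ sobolev j :=
  antitone_nat_of_succ_le sobolev_anti_succ h

theorem iterate_D_mem {j k : ℕ} {f : L2} (hf : f ∈ sobolev (k + j)) : D^[j] f ∈ sobolev k := by
  induction j generalizing f with
  | zero => exact hf
  | succ j ih =>
    rw [Function.iterate_succ_apply]
    exact ih (mem_sobolev_succ.1 hf).2

theorem D_add {f g : L2} (hf : f ∈ sobolev 1) (hg : g ∈ sobolev 1) : D (f + g) = D f + D g :=
  ((mem_sobolev_succ.1 hf).1.add (mem_sobolev_succ.1 hg).1).D_eq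

theorem D_smul {f : L2} (c : ℂ) (hf : f ∈ sobolev 1) : D (c • f) = c • D f :=
  ((mem_sobolev_succ.1 hf).1.smul c).D_eq

theorem iterate_D_add {k : ℕ} {f g : L2} (hf : f ∈ sobolev k) (hg : g ∈ sobolev k) :
    D^[k] (f + g) = D^[k] f + D^[k] g := by
  induction k generalizing f g with
  | zero => rfl
  | succ k ih =>
    rw [Function.iterate_succ_apply, D_add (sobolev_anti (by omega) hf)
      (sobolev_anti (by omega) hg)]
    exact ih (mem_sobolev_succ.1 hf).2 (mem_sobolev_succ.1 hg).2

theorem iterate_D_smul {k : ℕ} {f : L2} (c : ℂ) (hf : f ∈ sobolev k) :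
    D^[k] (c • f) = c • D^[k] f := by
  induction k generalizing f with
  | zero => rfl
  | succ k ih =>
    rw [Function.iterate_succ_apply, D_smul c (sobolev_anti (by omega) hf)]
    exact ih (mem_sobolev_succ.1 hf).2

instance : IsProbabilityMeasure (volume.restrict (Ioo (0 : ℝ) 1)) := ⟨by simp⟩

theorem intervalIntegrable_coe (g : L2) {a b : ℝ} (ha : a ∈ Icc (0 : ℝ) 1) (hb : b ∈ Icc (0 : ℝ) 1) :
    IntervalIntegrable g volume a b := by
  have hi : IntegrableOn g (Ioo (0 : ℝ) 1) := (Lp.memLp g).integrable (by norm_num)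
  rw [← integrableOn_Icc_iff_integrableOn_Ioo] at hi
  exact (hi.mono_set (uIcc_subset_Icc ha hb)).intervalIntegrable

theorem integral_norm_le (g : L2) : ∫ s in Ioo (0 : ℝ) 1, ‖g s‖ ≤ ‖g‖ := by
  have h := eLpNorm_le_eLpNorm_of_exponent_le (μ := volume.restrict (Ioo (0 : ℝ) 1))
    (p := 1) (q := 2) (by norm_num) (Lp.aestronglyMeasurable g)
  rw [Lp.norm_def, integral_norm_eq_lintegral_enorm (Lp.aestronglyMeasurable g),
    ← eLpNorm_one_eq_lintegral_enorm]
  exact ENNReal.toReal_mono (Lp.eLpNorm_ne_top g) h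

theorem norm_primitive_le (g : L2) {s : ℝ} (hs : s ∈ Icc (0 : ℝ) 1) :
    ‖∫ r in (0 : ℝ)..s, g r‖ ≤ ‖g‖ := by
  have hi : IntegrableOn g (Ioo (0 : ℝ) 1) := (Lp.memLp g).integrable (by norm_num)
  refine (intervalIntegral.norm_integral_le_integral_norm hs.1).trans
    (le_trans ?_ (integral_norm_le g))
  rw [intervalIntegral.integral_of_le hs.1, integral_Ioc_eq_integral_Ioo]
  exact setIntegral_mono_set hi.norm (ae_of_all _ fun _ => norm_nonneg _)
    (Ioo_subset_Ioo_right hs.2).eventuallyLE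

theorem continuousOn_primitive (g : L2) :
    ContinuousOn (fun s => ∫ r in (0 : ℝ)..s, g r) (Icc 0 1) := by
  have := intervalIntegral.continuousOn_primitive_interval' (a := 0) (b₁ := 0) (b₂ := 1)
    (intervalIntegrable_coe g (by simp) (by simp)) (by simp)
  rwa [uIcc_of_le zero_le_one] at this

theorem memLp_primitive (g : L2) :
    MemLp (fun s => ∫ r in (0 : ℝ)..s, g r) 2 (volume.restrict (Ioo (0 : ℝ) 1)) := by
  refine MemLp.of_bound (((continuousOn_primitive g).mono Ioo_subset_Icc_self).aestronglyMeasurable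
    measurableSet_Ioo) ‖g‖ ?_
  filter_upwards [ae_restrict_mem measurableSet_Ioo] with s hs
  exact norm_primitive_le g (Ioo_subset_Icc_self hs)

/-- The integration operator `(V g)(s) = ∫₀ˢ g`. -/
def V : L2 →L[ℂ] L2 :=
  LinearMap.mkContinuous
    { toFun := fun g => (memLp_primitive g).toLp _
      map_add' := by
        intro f g
        rw [← MemLp.toLp_add]
        refine MemLp.toLp_congr _ _ ?_
        filter_upwards [ae_restrict_mem measurableSet_Ioo] with s hs
        have hs' := Ioo_subset_Icc_self hs
        rw [Pi.add_apply, ← intervalIntegral.integral_add (intervalIntegrable_coe f (by simp) hs')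
          (intervalIntegrable_coe g (by simp) hs')]
        refine intervalIntegral.integral_congr_ae_restrict ?_
        rw [uIoc_of_le hs.1.le]
        refine ae_restrict_of_ae_restrict_of_subset (Ioc_subset_Ioo_right hs.2) ?_
        exact Lp.coeFn_add f g
      map_smul' := by
        intro c g
        rw [RingHom.id_apply, ← MemLp.toLp_const_smul]
        refine MemLp.toLp_congr _ _ ?_
        filter_upwards [ae_restrict_mem measurableSet_Ioo] with s hs
        rw [Pi.smul_apply, ← intervalIntegral.integral_smul]
        refine intervalIntegral.integral_congr_ae_restrict ?_
        rw [uIoc_of_le hs.1.le]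
        refine ae_restrict_of_ae_restrict_of_subset (Ioc_subset_Ioo_right hs.2) ?_
        exact Lp.coeFn_smul c g } 1 (by
    intro g
    have := Lp.norm_le_of_ae_bound (f := (memLp_primitive g).toLp _) (C := ‖g‖) (norm_nonneg g) (by
      filter_upwards [(memLp_primitive g).coeFn_toLp, ae_restrict_mem measurableSet_Ioo] with s h hs
      rw [h]
      exact norm_primitive_le g (Ioo_subset_Icc_self hs))
    simpa [measureUnivNNReal] using this)

theorem V_ae (g : L2) :
    V g =ᵐ[volume.restrict (Ioo (0 : ℝ) 1)] fun s => ∫ r in (0 : ℝ)..s, g r :=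
  (memLp_primitive g).coeFn_toLp

theorem setIntegral_eq {E : Type*} [NormedAddCommGroup E] [NormedSpace ℝ E] (f : ℝ → E) :
    ∫ s in Ioo (0 : ℝ) 1, f s = ∫ s in (0 : ℝ)..1, f s := by
  rw [intervalIntegral.integral_of_le zero_le_one, integral_Ioc_eq_integral_Ioo]

theorem test_zero {φ : ℝ → ℝ} (h : tsupport φ ⊆ Ioo 0 1) : φ 0 = 0 ∧ φ 1 = 0 :=
  ⟨image_eq_zero_of_notMem_tsupport fun h' => (lt_irrefl _ (h h').1),
    image_eq_zero_of_notMem_tsupport fun h' => (lt_irrefl _ (h h').2)⟩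

theorem hasWeakDeriv_V (g : L2) : HasWeakDeriv (V g) g := by
  have hd := BoundedContinuousFunction.toLp_denseRange ℂ
    (volume.restrict (Ioo (0 : ℝ) 1)) ℂ (p := 2) (by norm_num)
  refine hd.induction_on (p := fun g => HasWeakDeriv (V g) g) g
    (isClosed_hasWeakDeriv.preimage (f := fun g : L2 => (V g, g)) (by fun_prop)) ?_
  intro u φ h1 h2 h3
  have hu : BoundedContinuousFunction.toLp 2 (volume.restrict (Ioo (0 : ℝ) 1)) ℂ u
      =ᵐ[volume.restrict (Ioo (0 : ℝ) 1)] u :=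
    BoundedContinuousFunction.coeFn_toLp _ _ _ _
  set g := BoundedContinuousFunction.toLp 2 (volume.restrict (Ioo (0 : ℝ) 1)) ℂ u with hg
  have e1 : ∫ s in Ioo (0 : ℝ) 1, deriv φ s • (V g) s =
      ∫ s in Ioo (0 : ℝ) 1, deriv φ s • ∫ r in (0 : ℝ)..s, u r := by
    refine integral_congr_ae ?_
    filter_upwards [V_ae g, ae_restrict_mem measurableSet_Ioo] with s hs hs'
    rw [hs]
    congr 1
    refine intervalIntegral.integral_congr_ae_restrict ?_
    rw [uIoc_of_le hs'.1.le]
    exact ae_restrict_of_ae_restrict_of_subset (Ioc_subset_Ioo_right hs'.2) hu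
  have e2 : ∫ s in Ioo (0 : ℝ) 1, φ s • g s = ∫ s in Ioo (0 : ℝ) 1, φ s • u s := by
    refine integral_congr_ae ?_
    filter_upwards [hu] with s hs
    rw [hs]
  rw [e1, e2, setIntegral_eq, setIntegral_eq, eq_neg_iff_add_eq_zero, add_comm]
  have hφ' : Continuous (deriv φ) := h1.continuous_deriv (by simp)
  have hp : ∀ s, HasDerivAt (fun s => ∫ r in (0 : ℝ)..s, u r) (u s) s := fun s =>
    u.continuous.integral_hasStrictDerivAt 0 s |>.hasDerivAt
  have hpc : Continuous (fun s => ∫ r in (0 : ℝ)..s, u r) :=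
    continuous_iff_continuousAt.2 fun s => (hp s).continuousAt
  rw [← intervalIntegral.integral_add
    (Continuous.intervalIntegrable (by fun_prop) _ _)
    (Continuous.intervalIntegrable (by fun_prop) _ _)]
  rw [intervalIntegral.integral_eq_sub_of_hasDerivAt
    (f := fun s => φ s • ∫ r in (0 : ℝ)..s, u r)]
  · simp [(test_zero h3).2]
  · intro s _
    exact ((h1.differentiable (by simp)).differentiableAt.hasDerivAt).smul (hp s)
  · exact ((h1.continuous.smul u.continuous).add (hφ'.smul hpc)).intervalIntegrable _ _

theorem exists_test_primitive {θ : ℝ → ℝ} (hθ : ContDiff ℝ ∞ θ) {K : Set ℝ} (hK : IsCompact K)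
    (hne : K.Nonempty) (hK1 : K ⊆ Ioo 0 1) (hs : ∀ s ∉ K, θ s = 0)
    (h0 : ∫ s in (0 : ℝ)..1, θ s = 0) :
    ∃ ψ : ℝ → ℝ, ContDiff ℝ ∞ ψ ∧ HasCompactSupport ψ ∧ tsupport ψ ⊆ Ioo 0 1 ∧ deriv ψ = θ := by
  obtain ⟨a, haK, ha⟩ := hK.exists_isLeast hne
  obtain ⟨b, hbK, hb⟩ := hK.exists_isGreatest hne
  have hθi : ∀ x y, IntervalIntegrable θ volume x y := fun x y =>
    hθ.continuous.intervalIntegrable x y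
  have hd : ∀ s, HasDerivAt (fun s => ∫ r in (0 : ℝ)..s, θ r) (θ s) s := fun s =>
    hθ.continuous.integral_hasStrictDerivAt 0 s |>.hasDerivAt
  have hd' : deriv (fun s => ∫ r in (0 : ℝ)..s, θ r) = θ := funext fun s => (hd s).deriv
  have hsupp : tsupport (fun s => ∫ r in (0 : ℝ)..s, θ r) ⊆ Icc a b := by
    refine closure_minimal ?_ isClosed_Icc
    intro s hs'
    by_contra hsn
    apply hs'
    rw [mem_Icc, not_and_or, not_le, not_le] at hsn
    have ha0 := (hK1 haK).1
    have hb1 := (hK1 hbK).2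
    rcases hsn with hsn | hsn
    · refine intervalIntegral.integral_zero_ae (ae_of_all _ fun r hr => hs r fun hrK => ?_)
      have h1 : r ≤ max 0 s := hr.2
      have h2 := ha hrK
      have : max 0 s < a := max_lt ha0 hsn
      linarith
    · have hz : ∫ r in (1 : ℝ)..s, θ r = 0 := by
        refine intervalIntegral.integral_zero_ae (ae_of_all _ fun r hr => hs r fun hrK => ?_)
        have h1 : min 1 s < r := hr.1
        have h2 := hb hrK
        have : b < min 1 s := lt_min hb1 hsn
        linarith
      show ∫ r in (0 : ℝ)..s, θ r = 0
      rw [← intervalIntegral.integral_add_adjacent_intervals (hθi 0 1) (hθi 1 s), h0, hz, add_zero]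
  refine ⟨_, ?_, isCompact_Icc.of_isClosed_subset (isClosed_tsupport _) hsupp,
    hsupp.trans fun s hs' => ⟨(hK1 haK).1.trans_le hs'.1, hs'.2.trans_lt (hK1 hbK).2⟩, hd'⟩
  rw [contDiff_infty_iff_deriv, hd']
  exact ⟨fun s => (hd s).differentiableAt, hθ⟩

theorem eq_const_of_hasWeakDeriv_zero {f : L2} (hf : HasWeakDeriv f 0) :
    ∃ c : ℂ, f = Lp.const 2 (volume.restrict (Ioo (0 : ℝ) 1)) c := by
  let B : ContDiffBump (1 / 2 : ℝ) := ⟨1 / 8, 1 / 4, by norm_num, by norm_num⟩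
  let h : ℝ → ℝ := B.normed volume
  have hh : ContDiff ℝ ∞ h := B.contDiff_normed
  have hB : tsupport h = Metric.closedBall (1 / 2) (1 / 4) := B.tsupport_normed_eq
  have hB1 : Metric.closedBall (1 / 2 : ℝ) (1 / 4) ⊆ Ioo 0 1 := by
    rw [Real.closedBall_eq_Icc]
    intro s hs
    constructor <;> [linarith [hs.1]; linarith [hs.2]]
  have hint : ∫ s in (0 : ℝ)..1, h s = 1 := by
    rw [← setIntegral_eq, setIntegral_eq_integral_of_forall_compl_eq_zero, B.integral_normed]
    intro s hs
    exact image_eq_zero_of_notMem_tsupport fun h' => hs (hB1 (hB ▸ h'))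
  refine ⟨∫ s in Ioo (0 : ℝ) 1, h s • f s, ?_⟩
  rw [← sub_eq_zero]
  refine eq_zero_of_test fun φ h1 h2 h3 => ?_
  set c := ∫ s in (0 : ℝ)..1, φ s with hc
  obtain ⟨ψ, k1, k2, k3, k4⟩ := exists_test_primitive (θ := fun s => φ s - c * h s)
    (K := tsupport φ ∪ tsupport h) (by fun_prop)
    (h2.isCompact.union (hB ▸ isCompact_closedBall _ _))
    (Nonempty.inr (hB ▸ ⟨1 / 2, by simp⟩)) (union_subset h3 (hB ▸ hB1))
    (by
      intro s hs
      rw [mem_union, not_or] at hs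
      simp [image_eq_zero_of_notMem_tsupport hs.1, image_eq_zero_of_notMem_tsupport hs.2])
    (by
      rw [intervalIntegral.integral_sub (h1.continuous.intervalIntegrable _ _)
        ((hh.continuous.const_mul c).intervalIntegrable _ _),
        intervalIntegral.integral_const_mul, hint, mul_one, sub_self])
  have key := hf ψ k1 k2 k3
  rw [k4] at key
  obtain ⟨p, hp⟩ := exists_inner_repr h1.continuous
  obtain ⟨q, hq⟩ := exists_inner_repr hh.continuous
  obtain ⟨r, hr⟩ := exists_inner_repr k1.continuous
  have hfi : Integrable f (volume.restrict (Ioo (0 : ℝ) 1)) :=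
    (Lp.memLp f).integrable (by norm_num)
  have smul_int : ∀ χ : ℝ → ℝ, Continuous χ →
      Integrable (fun s => χ s • f s) (volume.restrict (Ioo (0 : ℝ) 1)) := by
    intro χ hχ
    obtain ⟨C, hC⟩ := (isCompact_Icc (a := (0 : ℝ)) (b := 1)).exists_bound_of_continuousOn
      hχ.continuousOn
    refine hfi.bdd_smul C hχ.aestronglyMeasurable ?_
    filter_upwards [ae_restrict_mem measurableSet_Ioo] with s hs
    exact hC s (Ioo_subset_Icc_self hs)
  rw [hr, inner_zero_right, neg_zero] at key
  have e : ∫ s in Ioo (0 : ℝ) 1, (φ s - c * h s) • f s =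
      (∫ s in Ioo (0 : ℝ) 1, φ s • f s) - c • ∫ s in Ioo (0 : ℝ) 1, h s • f s := by
    have hi2 : Integrable (fun s => c • h s • f s) (volume.restrict (Ioo (0 : ℝ) 1)) :=
      (smul_int h hh.continuous).smul c
    rw [← integral_smul, ← integral_sub (smul_int φ h1.continuous) hi2]
    refine integral_congr_ae (ae_of_all _ fun s => ?_)
    simp only [sub_smul, mul_smul]
  rw [e] at key
  have e3 : ∀ C : ℂ, ∫ s in Ioo (0 : ℝ) 1, φ s •
      (Lp.const 2 (volume.restrict (Ioo (0 : ℝ) 1)) C : L2) s = c • C := by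
    intro C
    rw [hc, ← setIntegral_eq, ← integral_smul_const]
    refine integral_congr_ae ?_
    filter_upwards [Lp.coeFn_const 2 (volume.restrict (Ioo (0 : ℝ) 1)) C] with s hs
    rw [hs, Function.const_apply]
  rw [hp, inner_sub_right, ← hp, ← hp, e3]
  exact key

theorem HasWeakDeriv.eq_V_add {f g : L2} (h : HasWeakDeriv f g) :
    ∃ c : ℂ, f = V g + Lp.const 2 (volume.restrict (Ioo (0 : ℝ) 1)) c := by
  obtain ⟨c, hc⟩ := eq_const_of_hasWeakDeriv_zero (f := f - V g)
    (by simpa using h.sub (hasWeakDeriv_V g))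
  exact ⟨c, by rw [← hc]; abel⟩

/-- `F` is the continuous representative on `[0,1]` of `f ∈ L₂(0,1)`. -/
def IsContRep (f : L2) (F : ℝ → ℂ) : Prop :=
  ContinuousOn F (Icc 0 1) ∧ f =ᵐ[volume.restrict (Ioo (0 : ℝ) 1)] F

open Classical in
/-- The boundary value (trace) `f(a)` at `a ∈ [0,1]`: the value at `a` of the continuous
representative of `f` (and `0` if there is none). -/
def trace (a : ℝ) (f : L2) : ℂ := if h : ∃ F, IsContRep f F then h.choose a else 0

theorem IsContRep.trace_eq {f : L2} {F : ℝ → ℂ} (h : IsContRep f F) {a : ℝ}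
    (ha : a ∈ Icc (0 : ℝ) 1) : trace a f = F a := by
  have h' : ∃ F, IsContRep f F := ⟨F, h⟩
  rw [trace, dif_pos h']
  have hs := h'.choose_spec
  refine Measure.eqOn_Icc_of_ae_eq volume zero_ne_one ?_ hs.1 h.1 ha
  have := hs.2.symm.trans h.2
  rwa [Measure.restrict_congr_set Ioo_ae_eq_Icc] at this

theorem IsContRep.add {f g : L2} {F G : ℝ → ℂ} (hf : IsContRep f F) (hg : IsContRep g G) :
    IsContRep (f + g) (F + G) :=
  ⟨hf.1.add hg.1, (Lp.coeFn_add f g).trans (hf.2.add hg.2)⟩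

theorem IsContRep.smul {f : L2} {F : ℝ → ℂ} (c : ℂ) (hf : IsContRep f F) :
    IsContRep (c • f) (c • F) :=
  ⟨hf.1.const_smul c, (Lp.coeFn_smul c f).trans (hf.2.const_smul c)⟩

theorem isContRep_const (c : ℂ) : IsContRep (Lp.const 2 _ c) (fun _ => c) :=
  ⟨continuousOn_const, Lp.coeFn_const _ _ _⟩

theorem isContRep_V (g : L2) : IsContRep (V g) (fun s => ∫ r in (0 : ℝ)..s, g r) :=
  ⟨continuousOn_primitive g, V_ae g⟩

theorem exists_isContRep {f : L2} (hf : f ∈ sobolev 1) : ∃ F, IsContRep f F := by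
  obtain ⟨c, hc⟩ := (mem_sobolev_succ.1 hf).1.eq_V_add
  rw [hc]
  exact ⟨_, (isContRep_V _).add (isContRep_const c)⟩

theorem trace_add {a : ℝ} (ha : a ∈ Icc (0 : ℝ) 1) {f g : L2} (hf : f ∈ sobolev 1)
    (hg : g ∈ sobolev 1) : trace a (f + g) = trace a f + trace a g := by
  obtain ⟨F, hF⟩ := exists_isContRep hf
  obtain ⟨G, hG⟩ := exists_isContRep hg
  rw [(hF.add hG).trace_eq ha, hF.trace_eq ha, hG.trace_eq ha, Pi.add_apply]

theorem trace_smul {a : ℝ} (ha : a ∈ Icc (0 : ℝ) 1) {f : L2} (c : ℂ) (hf : f ∈ sobolev 1) :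
    trace a (c • f) = c * trace a f := by
  obtain ⟨F, hF⟩ := exists_isContRep hf
  rw [(hF.smul c).trace_eq ha, hF.trace_eq ha, Pi.smul_apply, smul_eq_mul]

theorem trace_V (g : L2) : trace 0 (V g) = 0 := by
  rw [(isContRep_V g).trace_eq (by simp)]
  exact intervalIntegral.integral_same

theorem eq_V_of_trace {f : L2} (hf : f ∈ sobolev 1) (h0 : trace 0 f = 0) : f = V (D f) := by
  obtain ⟨c, hc⟩ := (mem_sobolev_succ.1 hf).1.eq_V_add
  have : c = 0 := by
    rw [hc, ((isContRep_V _).add (isContRep_const c)).trace_eq (by simp)] at h0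
    simpa using h0
  rw [this] at hc
  simpa using hc

/-- `Ŵ₂ᵏ(0,1) = {f ∈ W₂ᵏ(0,1) : f(0) = 0}`, for `k ≥ 1`. -/
def sobolevHat (k : ℕ) [NeZero k] : Submodule ℂ L2 where
  carrier := {f | f ∈ sobolev k ∧ trace 0 f = 0}
  add_mem' := by
    rintro f g ⟨hf, hf0⟩ ⟨hg, hg0⟩
    have h1 := sobolev_anti (NeZero.one_le (n := k))
    exact ⟨add_mem hf hg, by rw [trace_add (by simp) (h1 hf) (h1 hg), hf0, hg0, add_zero]⟩
  zero_mem' := ⟨zero_mem _, by simpa using trace_V 0⟩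
  smul_mem' := by
    rintro c f ⟨hf, hf0⟩
    have h1 := sobolev_anti (NeZero.one_le (n := k))
    exact ⟨Submodule.smul_mem _ c hf, by rw [trace_smul (by simp) c (h1 hf), hf0, mul_zero]⟩

/-- The energy space `𝕏 = Ŵ₂²(0,1) × L₂(0,1)`. Its inner product, defined below, depends on
`γ - η²`, which has to be positive. -/
def EnergySpace {γ η : ℝ} (_h : η ^ 2 < γ) : Type :=
  ↥((sobolevHat 2).prod (⊤ : Submodule ℂ L2))

namespace EnergySpace

variable {γ η : ℝ} {h : η ^ 2 < γ}

instance : AddCommGroup (EnergySpace h) :=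
  inferInstanceAs (AddCommGroup ↥((sobolevHat 2).prod (⊤ : Submodule ℂ L2)))

instance : Module ℂ (EnergySpace h) :=
  inferInstanceAs (Module ℂ ↥((sobolevHat 2).prod (⊤ : Submodule ℂ L2)))

/-- The first component `w` of `x = (w, v) ∈ 𝕏`. -/
def w (x : EnergySpace h) : L2 := x.1.1

/-- The second component `v` of `x = (w, v) ∈ 𝕏`. -/
def v (x : EnergySpace h) : L2 := x.1.2

/-- The element `(w, v)` of `𝕏`. -/
def mk (w v : L2) (hw : w ∈ sobolevHat 2) : EnergySpace h := ⟨(w, v), hw, trivial⟩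

@[simp] theorem w_mk (w v : L2) (hw : w ∈ sobolevHat 2) : (mk w v hw : EnergySpace h).w = w := rfl
@[simp] theorem v_mk (w v : L2) (hw : w ∈ sobolevHat 2) : (mk w v hw : EnergySpace h).v = v := rfl
@[simp] theorem w_add (x y : EnergySpace h) : (x + y).w = x.w + y.w := rfl
@[simp] theorem v_add (x y : EnergySpace h) : (x + y).v = x.v + y.v := rfl
@[simp] theorem w_smul (c : ℂ) (x : EnergySpace h) : (c • x).w = c • x.w := rfl
@[simp] theorem v_smul (c : ℂ) (x : EnergySpace h) : (c • x).v = c • x.v := rfl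
@[simp] theorem w_zero : (0 : EnergySpace h).w = 0 := rfl
@[simp] theorem v_zero : (0 : EnergySpace h).v = 0 := rfl
@[simp] theorem w_sub (x y : EnergySpace h) : (x - y).w = x.w - y.w := rfl
@[simp] theorem v_sub (x y : EnergySpace h) : (x - y).v = x.v - y.v := rfl

@[ext] theorem ext {x y : EnergySpace h} (hw : x.w = y.w) (hv : x.v = y.v) : x = y :=
  Subtype.ext (Prod.ext hw hv)

theorem w_mem (x : EnergySpace h) : x.w ∈ sobolevHat 2 := x.2.1

theorem w_mem_two (x : EnergySpace h) : x.w ∈ sobolev 2 := x.w_mem.1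

theorem w_mem_one (x : EnergySpace h) : x.w ∈ sobolev 1 := sobolev_anti one_le_two x.w_mem_two

theorem Dw_add (x y : EnergySpace h) : D (x + y).w = D x.w + D y.w :=
  D_add x.w_mem_one y.w_mem_one

theorem Dw_smul (c : ℂ) (x : EnergySpace h) : D (c • x).w = c • D x.w :=
  D_smul c x.w_mem_one

theorem DDw_add (x y : EnergySpace h) : D^[2] (x + y).w = D^[2] x.w + D^[2] y.w :=
  iterate_D_add x.w_mem_two y.w_mem_two

theorem DDw_smul (c : ℂ) (x : EnergySpace h) : D^[2] (c • x).w = c • D^[2] x.w :=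
  iterate_D_smul c x.w_mem_two

variable (h) in
/-- The energy inner product
`⟪x₁, x₂⟫ = ∫₀¹ (w₁'' w₂'' + (γ - η²) w₁' w₂' + v₁ v₂)`, where the first factors carry a complex
conjugation. -/
abbrev core : InnerProductSpace.Core ℂ (EnergySpace h) where
  inner x y := ⟪D^[2] x.w, D^[2] y.w⟫_ℂ + ((γ - η ^ 2 : ℝ) : ℂ) * ⟪D x.w, D y.w⟫_ℂ + ⟪x.v, y.v⟫_ℂ
  conj_inner_symm x y := by simp
  re_inner_nonneg x := by
    have h1 : (0 : ℝ) ≤ γ - η ^ 2 := by linarith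
    rw [map_add, map_add]
    change 0 ≤ RCLike.re _ + (((γ - η ^ 2 : ℝ) : ℂ) * ⟪D x.w, D x.w⟫_ℂ).re + RCLike.re _
    rw [Complex.re_ofReal_mul]
    exact add_nonneg (add_nonneg inner_self_nonneg (mul_nonneg h1 (inner_self_nonneg (𝕜 := ℂ))))
      inner_self_nonneg
  add_left x y z := by
    simp only [DDw_add, Dw_add, v_add, inner_add_left]; ring
  smul_left x y c := by
    simp only [DDw_smul, Dw_smul, v_smul, inner_smul_left]; ring
  definite x hx := by
    have h1 : (0 : ℝ) < γ - η ^ 2 := by linarith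
    have h2 := congrArg Complex.re hx
    rw [Complex.add_re, Complex.add_re, Complex.re_ofReal_mul, Complex.zero_re] at h2
    have a1 : 0 ≤ (⟪D^[2] x.w, D^[2] x.w⟫_ℂ).re := inner_self_nonneg (𝕜 := ℂ)
    have a2 : 0 ≤ (⟪D x.w, D x.w⟫_ℂ).re := inner_self_nonneg (𝕜 := ℂ)
    have a3 : 0 ≤ (⟪x.v, x.v⟫_ℂ).re := inner_self_nonneg (𝕜 := ℂ)
    have a4 := mul_nonneg h1.le a2
    have b2 : (⟪D x.w, D x.w⟫_ℂ).re = 0 := by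
      have : (γ - η ^ 2) * (⟪D x.w, D x.w⟫_ℂ).re = 0 := by linarith
      exact (mul_eq_zero.1 this).resolve_left h1.ne'
    have b3 : (⟪x.v, x.v⟫_ℂ).re = 0 := by linarith
    have c2 : D x.w = 0 :=
      norm_eq_zero.1 (pow_eq_zero_iff two_ne_zero |>.1
        ((inner_self_eq_norm_sq (𝕜 := ℂ) _).symm.trans b2))
    have c3 : x.v = 0 :=
      norm_eq_zero.1 (pow_eq_zero_iff two_ne_zero |>.1
        ((inner_self_eq_norm_sq (𝕜 := ℂ) _).symm.trans b3))
    refine EnergySpace.ext ?_ c3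
    rw [eq_V_of_trace x.w_mem_one x.w_mem.2, c2, map_zero, w_zero]

instance : NormedAddCommGroup (EnergySpace h) := (core h).toNormedAddCommGroup

instance : InnerProductSpace ℂ (EnergySpace h) := InnerProductSpace.ofCore (core h).toCore

theorem inner_def (x y : EnergySpace h) : ⟪x, y⟫_ℂ =
    ⟪D^[2] x.w, D^[2] y.w⟫_ℂ + ((γ - η ^ 2 : ℝ) : ℂ) * ⟪D x.w, D y.w⟫_ℂ + ⟪x.v, y.v⟫_ℂ := rfl

theorem norm_sq (x : EnergySpace h) :
    ‖x‖ ^ 2 = ‖D^[2] x.w‖ ^ 2 + (γ - η ^ 2) * ‖D x.w‖ ^ 2 + ‖x.v‖ ^ 2 := by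
  rw [← inner_self_eq_norm_sq (𝕜 := ℂ), inner_def, map_add, map_add,
    ← inner_self_eq_norm_sq (𝕜 := ℂ) (D^[2] x.w), ← inner_self_eq_norm_sq (𝕜 := ℂ) (D x.w),
    ← inner_self_eq_norm_sq (𝕜 := ℂ) x.v]
  congr 2
  exact Complex.re_ofReal_mul _ _

theorem norm_formula (x : EnergySpace h) :
    ‖x‖ = √(∫ s in Ioo (0 : ℝ) 1,
      (‖(D^[2] x.w) s‖ ^ 2 + (γ - η ^ 2) * ‖(D x.w) s‖ ^ 2 + ‖x.v s‖ ^ 2)) := by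
  have hn : ∀ f : L2, ‖f‖ ^ 2 = ∫ s in Ioo (0 : ℝ) 1, ‖f s‖ ^ 2 := by
    intro f
    have := L2.inner_def (𝕜 := ℂ) f f
    rw [inner_self_eq_norm_sq_to_K] at this
    have h2 : ∫ s in Ioo (0 : ℝ) 1, ⟪f s, f s⟫_ℂ = ((∫ s in Ioo (0 : ℝ) 1, ‖f s‖ ^ 2 : ℝ) : ℂ) := by
      rw [← integral_complex_ofReal]
      refine integral_congr_ae (ae_of_all _ fun s => ?_)
      simp [inner_self_eq_norm_sq_to_K]
    rw [h2] at this
    exact Complex.ofReal_injective (by rw [← this]; simp)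
  have hi : ∀ f : L2, Integrable (fun s => ‖f s‖ ^ 2) (volume.restrict (Ioo (0 : ℝ) 1)) :=
    fun f => (Lp.memLp f).integrable_norm_pow (by norm_num)
  have hi2 : Integrable (fun s => ‖(D^[2] x.w) s‖ ^ 2 + (γ - η ^ 2) * ‖(D x.w) s‖ ^ 2)
      (volume.restrict (Ioo (0 : ℝ) 1)) := (hi _).add ((hi _).const_mul _)
  rw [integral_add hi2 (hi _), integral_add (hi _)
    ((hi _).const_mul _), integral_const_mul, ← hn, ← hn, ← hn, ← norm_sq,
    Real.sqrt_sq (norm_nonneg _)]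

instance : CompleteSpace (EnergySpace h) := by
  have hpos : (0 : ℝ) < γ - η ^ 2 := by linarith
  have bound2 : ∀ x : EnergySpace h, ‖D^[2] x.w‖ ≤ ‖x‖ := fun x => by
    refine le_of_sq_le_sq ?_ (norm_nonneg _)
    rw [norm_sq]
    have := mul_nonneg hpos.le (sq_nonneg ‖D x.w‖)
    nlinarith [sq_nonneg ‖x.v‖]
  have bound0 : ∀ x : EnergySpace h, ‖x.v‖ ≤ ‖x‖ := fun x => by
    refine le_of_sq_le_sq ?_ (norm_nonneg _)
    rw [norm_sq]
    have := mul_nonneg hpos.le (sq_nonneg ‖D x.w‖)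
    nlinarith [sq_nonneg ‖D^[2] x.w‖]
  have bound1 : ∀ x : EnergySpace h, ‖D x.w‖ ≤ (√(γ - η ^ 2))⁻¹ * ‖x‖ := fun x => by
    have hs : 0 < √(γ - η ^ 2) := Real.sqrt_pos.2 hpos
    rw [le_inv_mul_iff₀ hs]
    refine le_of_sq_le_sq ?_ (norm_nonneg _)
    rw [norm_sq, mul_pow, Real.sq_sqrt hpos.le]
    nlinarith [sq_nonneg ‖x.v‖, sq_nonneg ‖D^[2] x.w‖]
  have Dw_sub : ∀ x y : EnergySpace h, D (x - y).w = D x.w - D y.w := fun x y => by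
    rw [sub_eq_add_neg, ← neg_one_smul ℂ y, Dw_add, Dw_smul, neg_one_smul, ← sub_eq_add_neg]
  have DDw_sub : ∀ x y : EnergySpace h, D^[2] (x - y).w = D^[2] x.w - D^[2] y.w := fun x y => by
    rw [sub_eq_add_neg, ← neg_one_smul ℂ y, DDw_add, DDw_smul, neg_one_smul, ← sub_eq_add_neg]
  refine Metric.complete_of_cauchySeq_tendsto fun u hu => ?_
  have cau : ∀ (F : EnergySpace h → L2) (C : ℝ), (∀ x y, F (x - y) = F x - F y) →
      (∀ x, ‖F x‖ ≤ C * ‖x‖) → ∃ p, Tendsto (fun n => F (u n)) atTop (𝓝 p) := by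
    intro F C hF hC
    have hL : LipschitzWith C.toNNReal F := LipschitzWith.of_dist_le_mul fun x y => by
      rw [dist_eq_norm, dist_eq_norm, ← hF]
      exact (hC _).trans (mul_le_mul_of_nonneg_right (Real.le_coe_toNNReal C) (norm_nonneg _))
    exact cauchySeq_tendsto_of_complete (hL.uniformContinuous.comp_cauchySeq hu)
  obtain ⟨p, hp⟩ := cau (fun x => D^[2] x.w) 1 DDw_sub fun x => by simpa using bound2 x
  obtain ⟨q, hq⟩ := cau (fun x => D x.w) _ Dw_sub bound1
  obtain ⟨r, hr⟩ := cau (fun x => x.v) 1 (fun _ _ => rfl) fun x => by simpa using bound0 x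
  have hqp : HasWeakDeriv q p := by
    have := isClosed_hasWeakDeriv.mem_of_tendsto (hq.prodMk_nhds hp) (Eventually.of_forall
      fun n => (mem_sobolev_succ.1 (mem_sobolev_succ.1 (u n).w_mem_two).2).1)
    exact this
  have hVq := hasWeakDeriv_V q
  have hmem : V q ∈ sobolevHat 2 := ⟨⟨q, ⟨p, trivial, hqp⟩, hVq⟩, trace_V q⟩
  refine ⟨mk (V q) r hmem, ?_⟩
  have d1 : D (mk (V q) r hmem : EnergySpace h).w = q := hVq.D_eq
  have d2 : D^[2] (mk (V q) r hmem : EnergySpace h).w = p := by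
    change D (D (V q)) = p
    rw [hVq.D_eq, hqp.D_eq]
  rw [tendsto_iff_norm_sub_tendsto_zero]
  have key : Tendsto (fun n => ‖u n - mk (V q) r hmem‖ ^ 2) atTop (𝓝 0) := by
    have e : ∀ n, ‖u n - mk (V q) r hmem‖ ^ 2 = ‖D^[2] (u n).w - p‖ ^ 2 +
        (γ - η ^ 2) * ‖D (u n).w - q‖ ^ 2 + ‖(u n).v - r‖ ^ 2 := fun n => by
      rw [norm_sq, DDw_sub, Dw_sub, d1, d2, v_sub, v_mk]
    simp only [e]
    rw [tendsto_iff_norm_sub_tendsto_zero] at hp hq hr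
    simpa using ((hp.pow 2).add ((hq.pow 2).const_mul (γ - η ^ 2))).add (hr.pow 2)
  have := (Real.continuous_sqrt.tendsto 0).comp key
  simpa [Function.comp_def, Real.sqrt_sq (norm_nonneg _)] using this

end EnergySpace

section Operators

variable {γ η : ℝ} (h : η ^ 2 < γ)

theorem one_mem_Icc : (1 : ℝ) ∈ Icc (0 : ℝ) 1 := by simp

theorem zero_mem_Icc : (0 : ℝ) ∈ Icc (0 : ℝ) 1 := by simp

/-- The domain of `A`: the pairs `x = (w, v) ∈ 𝕏` with `w ∈ W₂⁴(0,1)`, `v ∈ Ŵ₂²(0,1)` and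
`w''(0) = 0`, `w''(1) + κ v'(1) = 0`, `w'''(1) - (γ - η²) w'(1) = 0`. -/
def domainA (κ : ℝ) : Submodule ℂ (EnergySpace h) where
  carrier := {x | x.w ∈ sobolev 4 ∧ x.v ∈ sobolevHat 2 ∧
    trace 0 (D^[2] x.w) = 0 ∧
    trace 1 (D^[2] x.w) + κ * trace 1 (D x.v) = 0 ∧
    trace 1 (D^[3] x.w) - ((γ - η ^ 2 : ℝ) : ℂ) * trace 1 (D x.w) = 0}
  add_mem' := by
    rintro x y ⟨hx, hx', x1, x2, x3⟩ ⟨hy, hy', y1, y2, y3⟩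
    have e2 : ∀ {f : L2}, f ∈ sobolev 4 → D^[2] f ∈ sobolev 1 := fun hf =>
      iterate_D_mem (k := 1) (j := 2) (sobolev_anti (by norm_num) hf)
    have e3 : ∀ {f : L2}, f ∈ sobolev 4 → D^[3] f ∈ sobolev 1 := fun hf =>
      iterate_D_mem (k := 1) (j := 3) hf
    have e1 : ∀ {f : L2}, f ∈ sobolev 2 → D f ∈ sobolev 1 := fun hf =>
      iterate_D_mem (k := 1) (j := 1) hf
    have s2 : D^[2] (x.w + y.w) = D^[2] x.w + D^[2] y.w :=
      iterate_D_add x.w_mem_two y.w_mem_two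
    have s3 : D^[3] (x.w + y.w) = D^[3] x.w + D^[3] y.w :=
      iterate_D_add (sobolev_anti (by norm_num) hx) (sobolev_anti (by norm_num) hy)
    have s1 : D (x.w + y.w) = D x.w + D y.w := D_add x.w_mem_one y.w_mem_one
    have t1 : D (x.v + y.v) = D x.v + D y.v :=
      D_add (sobolev_anti one_le_two hx'.1) (sobolev_anti one_le_two hy'.1)
    refine ⟨add_mem hx hy, add_mem hx' hy', ?_, ?_, ?_⟩
    · rw [EnergySpace.w_add, s2, trace_add zero_mem_Icc (e2 hx) (e2 hy), x1, y1, add_zero]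
    · rw [EnergySpace.w_add, EnergySpace.v_add, s2, t1, trace_add one_mem_Icc (e2 hx) (e2 hy),
        trace_add one_mem_Icc (e1 hx'.1) (e1 hy'.1)]
      linear_combination x2 + y2
    · rw [EnergySpace.w_add, s3, s1, trace_add one_mem_Icc (e3 hx) (e3 hy),
        trace_add one_mem_Icc (e1 x.w_mem_two) (e1 y.w_mem_two)]
      linear_combination x3 + y3
  zero_mem' := by
    have hD : D (0 : L2) = 0 := hasWeakDeriv_zero.D_eq
    have ht : ∀ a ∈ Icc (0 : ℝ) 1, trace a 0 = 0 := fun a ha => by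
      simpa using trace_smul ha 0 (zero_mem (sobolev 1))
    refine ⟨zero_mem _, zero_mem _, ?_⟩
    simp [hD, ht]
  smul_mem' := by
    rintro c x ⟨hx, hx', x1, x2, x3⟩
    have e2 : D^[2] x.w ∈ sobolev 1 :=
      iterate_D_mem (k := 1) (j := 2) (sobolev_anti (by norm_num) hx)
    have e3 : D^[3] x.w ∈ sobolev 1 := iterate_D_mem (k := 1) (j := 3) hx
    have e1 : ∀ {f : L2}, f ∈ sobolev 2 → D f ∈ sobolev 1 := fun hf =>
      iterate_D_mem (k := 1) (j := 1) hf
    have s2 : D^[2] (c • x.w) = c • D^[2] x.w := iterate_D_smul c x.w_mem_two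
    have s3 : D^[3] (c • x.w) = c • D^[3] x.w :=
      iterate_D_smul c (sobolev_anti (by norm_num) hx)
    have s1 : D (c • x.w) = c • D x.w := D_smul c x.w_mem_one
    have t1 : D (c • x.v) = c • D x.v := D_smul c (sobolev_anti one_le_two hx'.1)
    refine ⟨Submodule.smul_mem _ c hx, Submodule.smul_mem _ c hx', ?_, ?_, ?_⟩
    · rw [EnergySpace.w_smul, s2, trace_smul zero_mem_Icc c e2, x1, mul_zero]
    · rw [EnergySpace.w_smul, EnergySpace.v_smul, s2, t1, trace_smul one_mem_Icc c e2,
        trace_smul one_mem_Icc c (e1 hx'.1)]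
      linear_combination c * x2
    · rw [EnergySpace.w_smul, s3, s1, trace_smul one_mem_Icc c e3,
        trace_smul one_mem_Icc c (e1 x.w_mem_two)]
      linear_combination c * x3

/-- `A (w, v) = (v, -w⁗ + (γ - η²) w'')`. -/
def opA (κ : ℝ) : EnergySpace h →ₗ.[ℂ] EnergySpace h where
  domain := domainA h κ
  toFun :=
    { toFun := fun x => EnergySpace.mk x.1.v
        (-D^[4] x.1.w + ((γ - η ^ 2 : ℝ) : ℂ) • D^[2] x.1.w) x.2.2.1
      map_add' := by
        rintro ⟨x, hx⟩ ⟨y, hy⟩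
        refine EnergySpace.ext rfl ?_
        change -D^[4] (x.w + y.w) + _ • D^[2] (x.w + y.w) = (-_ + _) + (-_ + _)
        rw [iterate_D_add hx.1 hy.1, iterate_D_add x.w_mem_two y.w_mem_two, smul_add]
        abel
      map_smul' := by
        rintro c ⟨x, hx⟩
        refine EnergySpace.ext rfl ?_
        change -D^[4] (c • x.w) + _ • D^[2] (c • x.w) = c • (-_ + _)
        rw [iterate_D_smul c hx.1, iterate_D_smul c x.w_mem_two, smul_add, smul_neg, smul_comm] }

/-- The domain of `B`: the pairs `(w, v) ∈ 𝕏` with `v ∈ Ŵ₂¹(0,1)`. -/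
def domainB : Submodule ℂ (EnergySpace h) where
  carrier := {x | x.v ∈ sobolevHat 1}
  add_mem' := by
    intro x y hx hy
    exact (sobolevHat 1).add_mem hx hy
  zero_mem' := (sobolevHat 1).zero_mem
  smul_mem' := by
    intro c x hx
    exact (sobolevHat 1).smul_mem c hx

/-- `B (w, v) = (0, -2βη v')`. -/
def opB (β : ℝ) : EnergySpace h →ₗ.[ℂ] EnergySpace h where
  domain := domainB h
  toFun :=
    { toFun := fun x => EnergySpace.mk 0 (((-2 * β * η : ℝ) : ℂ) • D x.1.v) (zero_mem _)
      map_add' := by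
        rintro ⟨x, hx⟩ ⟨y, hy⟩
        refine EnergySpace.ext (add_zero (0 : L2)).symm ?_
        change _ • D (x.v + y.v) = _ • D x.v + _ • D y.v
        rw [D_add hx.1 hy.1, smul_add]
      map_smul' := by
        rintro c ⟨x, hx⟩
        refine EnergySpace.ext (smul_zero (A := L2) c).symm ?_
        change _ • D (c • x.v) = c • _ • D x.v
        rw [D_smul c hx.1, smul_comm] }

/-- The closed-loop operator `T = A + B`, on `D(A) ∩ D(B) = D(A)`. -/
def opT (β κ : ℝ) : EnergySpace h →ₗ.[ℂ] EnergySpace h := opA h κ + opB h β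

theorem opT_domain (β κ : ℝ) : (opT h β κ).domain = domainA h κ :=
  inf_eq_left.2 fun _ hx => ⟨sobolev_anti one_le_two hx.2.1.1, hx.2.1.2⟩

end Operators

section Abstract

variable {E : Type*} [NormedAddCommGroup E] [InnerProductSpace ℂ E]

/-- `T : D(T) → E` is bijective and its inverse is a compact operator on `E`. -/
def HasCompactInverse (T : E →ₗ.[ℂ] E) : Prop :=
  ∃ S : E →L[ℂ] E, IsCompactOperator S ∧ ∀ x y : E, (x, y) ∈ T.graph ↔ S y = x

/-- `Re ⟪T x, x⟫ ≤ 0` for all `x ∈ D(T)`. -/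
def IsDissipative (T : E →ₗ.[ℂ] E) : Prop :=
  ∀ x : T.domain, (⟪T x, (x : E)⟫_ℂ).re ≤ 0

/-- Maximal dissipative operators. Two formulations of maximality are in use, the absence of a
proper dissipative extension and the condition that `λ - T` maps `D(T)` onto `E` for every
`λ > 0`; both are required here (the second implies the first). -/
structure IsMaximalDissipative (T : E →ₗ.[ℂ] E) : Prop where
  dissipative : IsDissipative T
  eq_of_le : ∀ S : E →ₗ.[ℂ] E, IsDissipative S → T ≤ S → S = T
  surjective : ∀ l : ℝ, 0 < l → ∀ y : E, ∃ x : T.domain, (l : ℂ) • (x : E) - T x = y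

/-- `T` is densely defined and `T* = -T`, domains included. -/
def IsSkewAdjoint [CompleteSpace E] (T : E →ₗ.[ℂ] E) : Prop :=
  Dense (T.domain : Set E) ∧ T.adjoint = -T

/-- `U(t)`, `t ≥ 0`, is a `C₀`-semigroup of contractions on `E`. -/
structure IsContractionC0Semigroup (U : NNReal → E →L[ℂ] E) : Prop where
  map_zero : U 0 = ContinuousLinearMap.id ℂ E
  map_add : ∀ s t, U (s + t) = (U s).comp (U t)
  tendsto_zero : ∀ x, Tendsto (fun t => U t x) (𝓝 0) (𝓝 x)
  norm_le_one : ∀ t, ‖U t‖ ≤ 1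

/-- `T` is the infinitesimal generator of `U`: `x ∈ D(T)` and `T x = y` if and only if
`t⁻¹ (U(t) x - x) → y` as `t → 0+`. -/
def IsInfinitesimalGenerator (T : E →ₗ.[ℂ] E) (U : NNReal → E →L[ℂ] E) : Prop :=
  ∀ x y : E, (x, y) ∈ T.graph ↔
    Tendsto (fun t : NNReal => ((t : ℝ) : ℂ)⁻¹ • (U t x - x)) (𝓝[>] 0) (𝓝 y)

end Abstract

end

end FluidTube

/-!
The operator `T` is studied through its inverse. The equation `T (w, v) = (f, g)` means `v = f`
together with a boundary value problem of order four for `w`, whose weak form is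
`∫ w'' φ'' + (γ - η²) ∫ w' φ' = -∫ (g + 2βη f') φ - κ f'(1) φ'(1)` for all `φ ∈ Ŵ₂²(0,1)` (up to
conjugation). The left-hand side is the inner product of `𝕏` restricted to the first components, so
the Riesz representation theorem yields a bounded operator `S` on `𝕏` (`EnergySpace.inverse`). All
boundary conditions of `T` except `w(0) = v(0) = 0` are natural ones for this weak form:
regularity of the weak solution (`mem_domainA_of_weak`) and Green's formula
(`inner_add_of_mem_domainA`) show that `S` is the inverse of `T` (`mem_graph_opT_iff_inverse`).
`S` is compact because it factors through the Volterra operator `V`, which is compact by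
Arzelà–Ascoli (`isCompactOperator_V`). From the weak form,
`Re ⟪S y, y⟫ = -βη |w(1)|² - κ |w'(1)|² ≤ 0` for `y = (w, v)` (`re_inner_inverse`).

The rest is abstract: let `S` be bounded on a Hilbert space with `Re ⟪S y, y⟫ ≤ 0`, and let it be
the inverse of an operator `T`. Then `S - l` is coercive for `l > 0`, hence invertible, so that
`l - T` is onto for every `l > 0` and `T` is maximal dissipative. The range of `S`, which is the
domain of `T`, is dense, and if the real part vanishes then `S* = -S`, whence `T* = -T`. The
semigroup is the strong limit of `exp (t (S - l)⁻¹)` as `l → 0+`; here `(S - l)⁻¹ = T (1 - l T)⁻¹`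
is the Yosida approximation of `T` (`exists_semigroup_of_inverse`).
-/

namespace FluidTube

noncomputable section

/-! ### Strong limits of contractions -/

section Contractions

variable {E : Type*} [NormedAddCommGroup E] [InnerProductSpace ℂ E]

theorem norm_apply_le_of_norm_le_one {F : E →L[ℂ] E} (hF : ‖F‖ ≤ 1) (x : E) : ‖F x‖ ≤ ‖x‖ := by
  simpa using F.le_of_opNorm_le hF x

/-- For contractions, strong convergence on a dense set implies strong convergence. -/
theorem tendsto_of_dense {ι : Type*} {l : Filter ι} {F : ι → E →L[ℂ] E} (hF : ∀ i, ‖F i‖ ≤ 1)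
    {U : E →L[ℂ] E} (hU : ‖U‖ ≤ 1) {s : Set E} (hs : Dense s)
    (h : ∀ x ∈ s, Tendsto (fun i => F i x) l (𝓝 (U x))) (x : E) :
    Tendsto (fun i => F i x) l (𝓝 (U x)) := by
  rw [Metric.tendsto_nhds]
  intro ε hε
  obtain ⟨y, hy, hxy⟩ := hs.exists_dist_lt x (ε := ε / 3) (by positivity)
  filter_upwards [(Metric.tendsto_nhds.1 (h y hy)) (ε / 3) (by positivity)] with i hi
  have h1 := norm_apply_le_of_norm_le_one (hF i) (x - y)
  have h2 := norm_apply_le_of_norm_le_one hU (x - y)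
  rw [map_sub, ← dist_eq_norm, ← dist_eq_norm] at h1 h2
  have h3 := dist_triangle4 (F i x) (F i y) (U y) (U x)
  rw [dist_comm (U y)] at h3
  linarith

theorem tendsto_apply_of_norm_le_one {ι : Type*} {l : Filter ι} {F : ι → E →L[ℂ] E}
    (hF : ∀ i, ‖F i‖ ≤ 1) {z : ι → E} {z₀ u : E} (hz : Tendsto z l (𝓝 z₀))
    (h : Tendsto (fun i => F i z₀) l (𝓝 u)) : Tendsto (fun i => F i (z i)) l (𝓝 u) := by
  have h1 : Tendsto (fun i => F i (z i - z₀)) l (𝓝 0) := by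
    refine squeeze_zero_norm (fun i => norm_apply_le_of_norm_le_one (hF i) _) ?_
    exact tendsto_iff_norm_sub_tendsto_zero.1 hz
  simpa using h1.add h

/-- A sequence of contractions which is pointwise Cauchy on a dense set converges strongly to a
contraction. -/
theorem exists_tendsto_of_dense [CompleteSpace E] {F : ℕ → E →L[ℂ] E} (hF : ∀ n, ‖F n‖ ≤ 1)
    {s : Set E} (hs : Dense s) (h : ∀ x ∈ s, CauchySeq fun n => F n x) :
    ∃ U : E →L[ℂ] E, ‖U‖ ≤ 1 ∧ ∀ x, Tendsto (fun n => F n x) atTop (𝓝 (U x)) := by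
  have hc : ∀ x, ∃ u, Tendsto (fun n => F n x) atTop (𝓝 u) := by
    intro x
    refine cauchySeq_tendsto_of_complete (Metric.cauchySeq_iff.2 fun ε hε => ?_)
    obtain ⟨y, hy, hxy⟩ := hs.exists_dist_lt x (ε := ε / 3) (by positivity)
    obtain ⟨N, hN⟩ := Metric.cauchySeq_iff.1 (h y hy) (ε / 3) (by positivity)
    refine ⟨N, fun m hm n hn => ?_⟩
    have h1 := norm_apply_le_of_norm_le_one (hF m) (x - y)
    have h2 := norm_apply_le_of_norm_le_one (hF n) (x - y)
    rw [map_sub, ← dist_eq_norm, ← dist_eq_norm] at h1 h2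
    have h3 := dist_triangle4 (F m x) (F m y) (F n y) (F n x)
    rw [dist_comm (F n y)] at h3
    linarith [hN m hm n hn]
  choose u hu using hc
  let L : E →ₗ[ℂ] E := linearMapOfTendsto u (fun n => (F n : E →ₗ[ℂ] E)) (tendsto_pi_nhds.2 hu)
  have hL : ∀ x, ‖L x‖ ≤ 1 * ‖x‖ := fun x => by
    rw [one_mul]
    exact le_of_tendsto (hu x).norm (Eventually.of_forall fun n =>
      norm_apply_le_of_norm_le_one (hF n) x)
  exact ⟨L.mkContinuous 1 hL, L.mkContinuous_norm_le zero_le_one hL, hu⟩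

end Contractions

/-! ### Exponentials of bounded dissipative operators -/

section Exponential

open NormedSpace (exp)

variable {E : Type*} [NormedAddCommGroup E] [InnerProductSpace ℂ E] [CompleteSpace E]

theorem hasDerivAt_exp_smul_apply (A : E →L[ℂ] E) (x : E) (t : ℝ) :
    HasDerivAt (fun s : ℝ => exp (s • A) x) (exp (t • A) (A x)) t := by
  have h := hasDerivAt_exp_smul_const (𝕂 := ℝ) A t
  exact ((ContinuousLinearMap.apply ℂ E x).restrictScalars ℝ).hasFDerivAt.comp_hasDerivAt t h

theorem norm_exp_smul_le_one {A : E →L[ℂ] E} (hA : ∀ z, (⟪A z, z⟫_ℂ).re ≤ 0) {t : ℝ} (ht : 0 ≤ t) :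
    ‖exp (t • A)‖ ≤ 1 := by
  refine ContinuousLinearMap.opNorm_le_bound _ zero_le_one fun x => ?_
  have hd : ∀ s : ℝ, HasDerivAt (fun s : ℝ => (⟪exp (s • A) x, exp (s • A) x⟫_ℂ).re)
      (2 * (⟪A (exp (s • A) x), exp (s • A) x⟫_ℂ).re) s := by
    intro s
    have hc : exp (s • A) (A x) = A (exp (s • A) x) := by
      have : Commute (exp (s • A)) A := ((Commute.refl A).smul_left s).exp_left
      exact congrArg (fun L : E →L[ℂ] E => L x) this.eq
    have h0 := hasDerivAt_exp_smul_apply A x s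
    rw [hc] at h0
    have h1 := h0.inner ℂ h0
    have h2 := Complex.reCLM.hasFDerivAt.comp_hasDerivAt s h1
    refine h2.congr_deriv ?_
    change (⟪exp (s • A) x, A (exp (s • A) x)⟫_ℂ + ⟪A (exp (s • A) x), exp (s • A) x⟫_ℂ).re = _
    rw [Complex.add_re, ← inner_conj_symm (exp (s • A) x), Complex.conj_re, two_mul]
  have hanti := antitone_of_deriv_nonpos (fun s => (hd s).differentiableAt) fun s => by
    rw [(hd s).deriv]
    linarith [hA (exp (s • A) x)]
  have h3 := hanti ht
  simp only [zero_smul, NormedSpace.exp_zero, one_apply_eq_self] at h3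
  have e : ∀ y : E, (⟪y, y⟫_ℂ).re = ‖y‖ ^ 2 := fun y => inner_self_eq_norm_sq (𝕜 := ℂ) y
  rw [e, e] at h3
  rw [one_mul]
  exact le_of_sq_le_sq h3 (norm_nonneg _)

/-- The exponentials of two commuting dissipative operators differ at `x` by at most
`t ‖A x - B x‖`: differentiate `s ↦ exp (s A) exp ((t - s) B) x`. -/
theorem norm_exp_smul_sub_le {A B : E →L[ℂ] E} (hAB : Commute A B)
    (hA : ∀ z, (⟪A z, z⟫_ℂ).re ≤ 0) (hB : ∀ z, (⟪B z, z⟫_ℂ).re ≤ 0) {t : ℝ} (ht : 0 ≤ t) (x : E) :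
    ‖exp (t • A) x - exp (t • B) x‖ ≤ t * ‖A x - B x‖ := by
  have hd : ∀ s ∈ Icc 0 t, HasDerivWithinAt (fun s : ℝ => (exp (s • A) * exp ((t - s) • B)) x)
      ((exp (s • A) * exp ((t - s) • B)) (A x - B x)) (Icc 0 t) s := by
    intro s _
    have h1 := hasDerivAt_exp_smul_const (𝕂 := ℝ) A s
    have h2 := (hasDerivAt_exp_smul_const (𝕂 := ℝ) B (t - s)).scomp s
      ((hasDerivAt_id s).const_sub t)
    have h3 := ((ContinuousLinearMap.apply ℂ E x).restrictScalars ℝ).hasFDerivAt.comp_hasDerivAt s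
      (h1.mul h2)
    have hc : exp (s • A) * A * exp ((t - s) • B) = exp (s • A) * exp ((t - s) • B) * A := by
      have : Commute A (exp ((t - s) • B)) := (hAB.smul_right (t - s)).exp_right
      rw [mul_assoc, this.eq, mul_assoc]
    have e : (exp (s • A) * exp ((t - s) • B)) (A x - B x) =
        (exp (s • A) * A * exp ((t - s) • B) +
          exp (s • A) * ((-1 : ℝ) • (exp ((t - s) • B) * B))) x := by
      rw [hc, neg_one_smul, mul_neg, ← mul_assoc, ← sub_eq_add_neg, map_sub]
      rfl
    rw [e]
    exact h3.hasDerivWithinAt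
  have := norm_image_sub_le_of_norm_deriv_le_segment' (C := ‖A x - B x‖) hd (fun s hs => by
    exact (norm_apply_le_of_norm_le_one (norm_exp_smul_le_one hA hs.1) _).trans
      (norm_apply_le_of_norm_le_one (norm_exp_smul_le_one hB (by linarith [hs.2])) _)) t
    (right_mem_Icc.2 ht)
  simpa [mul_comm] using this

theorem norm_exp_smul_sub_self_le {A : E →L[ℂ] E} (hA : ∀ z, (⟪A z, z⟫_ℂ).re ≤ 0) {t : ℝ}
    (ht : 0 ≤ t) (x : E) : ‖exp (t • A) x - x‖ ≤ t * ‖A x‖ := by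
  simpa using norm_exp_smul_sub_le (B := 0) (Commute.zero_right A) hA (by simp) ht x

/-- A second-order estimate which involves `A` only through its values at `x` and at an
approximation `y` of `A x`, so that it survives the limit of unbounded `A`. -/
theorem norm_exp_smul_sub_sub_le {A : E →L[ℂ] E} (hA : ∀ z, (⟪A z, z⟫_ℂ).re ≤ 0) {t : ℝ}
    (ht : 0 ≤ t) (x y : E) :
    ‖exp (t • A) x - x - t • A x‖ ≤ t * (t * ‖A y‖ + 2 * ‖A x - y‖) := by
  have hd : ∀ s ∈ Icc 0 t, HasDerivWithinAt (fun s : ℝ => exp (s • A) x - x - s • A x)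
      (exp (s • A) (A x) - (1 : ℝ) • A x) (Icc 0 t) s := fun s _ =>
    (((hasDerivAt_exp_smul_apply A x s).sub_const x).sub
      ((hasDerivAt_id s).smul_const (A x))).hasDerivWithinAt
  have := norm_image_sub_le_of_norm_deriv_le_segment' (C := t * ‖A y‖ + 2 * ‖A x - y‖) hd
    (fun s hs => by
      have e : exp (s • A) (A x) - (1 : ℝ) • A x =
          (exp (s • A) (A x - y) - (A x - y)) + (exp (s • A) y - y) := by
        rw [map_sub, one_smul]; abel
      have h1 := norm_apply_le_of_norm_le_one (norm_exp_smul_le_one hA hs.1) (A x - y)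
      have h2 := norm_exp_smul_sub_self_le hA hs.1 y
      have h3 : s * ‖A y‖ ≤ t * ‖A y‖ := mul_le_mul_of_nonneg_right hs.2.le (norm_nonneg _)
      rw [e]
      linarith [norm_add_le (exp (s • A) (A x - y) - (A x - y)) (exp (s • A) y - y),
        norm_sub_le (exp (s • A) (A x - y)) (A x - y)]) t (right_mem_Icc.2 ht)
  simpa [mul_comm] using this

end Exponential

/-! ### Operators with a bounded dissipative inverse -/

section BoundedInverse

open NormedSpace (exp)

variable {E : Type*} [NormedAddCommGroup E] [InnerProductSpace ℂ E] {S : E →L[ℂ] E}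
  {T : E →ₗ.[ℂ] E}

theorem domain_eq_range (hT : ∀ x y, (x, y) ∈ T.graph ↔ S y = x) :
    (T.domain : Set E) = range S := by
  ext x
  constructor
  · intro hx
    exact ⟨T ⟨x, hx⟩, (hT _ _).1 (T.mem_graph ⟨x, hx⟩)⟩
  · rintro ⟨y, rfl⟩
    exact LinearPMap.mem_domain_of_mem_graph ((hT _ _).2 rfl)

theorem apply_eq_zero_of_graph (hT : ∀ x y, (x, y) ∈ T.graph ↔ S y = x) (z : E) (hz : S z = 0) :
    z = 0 := by
  have := (hT 0 z).2 hz
  exact LinearPMap.graph_fst_eq_zero_snd T this rfl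

/-- The Yosida approximation `(S - l)⁻¹ = T (1 - l T)⁻¹` of the inverse `T` of `S` (and `0` if
`S - l` is not invertible, which does not occur for `l > 0`). -/
def yosida (S : E →L[ℂ] E) (l : ℝ) : E →L[ℂ] E := Ring.inverse (S - (l : ℂ) • 1)

theorem commute_inverse_right {R : Type*} [MonoidWithZero R] {a b : R} (h : Commute a b) :
    Commute a (Ring.inverse b) := by
  by_cases hb : IsUnit b
  · obtain ⟨u, rfl⟩ := hb
    rw [Ring.inverse_unit]
    exact h.units_inv_right
  · rw [Ring.inverse_non_unit _ hb]
    exact Commute.zero_right a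

theorem commute_yosida (l : ℝ) : Commute S (yosida S l) :=
  commute_inverse_right ((Commute.refl S).sub_right ((Commute.one_right S).smul_right _))

theorem commute_yosida_yosida (l m : ℝ) : Commute (yosida S l) (yosida S m) :=
  commute_inverse_right
    ((commute_yosida l).symm.sub_right ((Commute.one_right (yosida S l)).smul_right (m : ℂ)))

variable [CompleteSpace E]

/-- If `-S` is accretive then `S - l` is coercive, hence invertible, for `l > 0`. -/
theorem isUnit_sub_smul_one (hS : ∀ z, (⟪S z, z⟫_ℂ).re ≤ 0) {l : ℝ} (hl : 0 < l) :
    IsUnit (S - (l : ℂ) • 1) := by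
  refine ContinuousLinearMap.isUnit_of_forall_le_norm_inner_map _ (c := l.toNNReal)
    (Real.toNNReal_pos.2 hl) fun x => ?_
  rw [Real.coe_toNNReal _ hl.le]
  have e : (⟪(S - (l : ℂ) • 1) x, x⟫_ℂ).re = (⟪S x, x⟫_ℂ).re - l * ‖x‖ ^ 2 := by
    have : (⟪x, x⟫_ℂ).re = ‖x‖ ^ 2 := inner_self_eq_norm_sq (𝕜 := ℂ) x
    change (⟪S x - (l : ℂ) • x, x⟫_ℂ).re = _
    rw [inner_sub_left, inner_smul_left, Complex.conj_ofReal, Complex.sub_re,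
      Complex.re_ofReal_mul, this]
  have := (abs_le.1 (Complex.abs_re_le_norm (⟪(S - (l : ℂ) • 1) x, x⟫_ℂ))).1
  rw [e] at this
  nlinarith [hS x]

theorem yosida_mul (hS : ∀ z, (⟪S z, z⟫_ℂ).re ≤ 0) {l : ℝ} (hl : 0 < l) :
    yosida S l * (S - (l : ℂ) • 1) = 1 := Ring.inverse_mul_cancel _ (isUnit_sub_smul_one hS hl)

theorem mul_yosida (hS : ∀ z, (⟪S z, z⟫_ℂ).re ≤ 0) {l : ℝ} (hl : 0 < l) :
    (S - (l : ℂ) • 1) * yosida S l = 1 := Ring.mul_inverse_cancel _ (isUnit_sub_smul_one hS hl)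

theorem surjective_sub_smul (hS : ∀ z, (⟪S z, z⟫_ℂ).re ≤ 0) {l : ℝ} (hl : 0 < l) (y : E) :
    ∃ z, S z - (l : ℂ) • z = y :=
  ⟨yosida S l y, congrArg (fun L : E →L[ℂ] E => L y) (mul_yosida hS hl)⟩

theorem yosida_dissipative (hS : ∀ z, (⟪S z, z⟫_ℂ).re ≤ 0) {l : ℝ} (hl : 0 < l) (y : E) :
    (⟪yosida S l y, y⟫_ℂ).re ≤ 0 := by
  obtain ⟨z, rfl⟩ := surjective_sub_smul hS hl y
  have e : yosida S l (S z - (l : ℂ) • z) = z :=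
    congrArg (fun L : E →L[ℂ] E => L z) (yosida_mul hS hl)
  have h1 : (⟪z, z⟫_ℂ).re = ‖z‖ ^ 2 := inner_self_eq_norm_sq (𝕜 := ℂ) z
  rw [e, inner_sub_right, inner_smul_right, Complex.sub_re, Complex.re_ofReal_mul, h1,
    ← inner_conj_symm, Complex.conj_re]
  nlinarith [hS z, sq_nonneg ‖z‖]

theorem yosida_apply_apply (hS : ∀ z, (⟪S z, z⟫_ℂ).re ≤ 0) {l : ℝ} (hl : 0 < l) (y : E) :
    yosida S l (S y) = y + (l : ℂ) • yosida S l y := by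
  have := congrArg (fun L : E →L[ℂ] E => L y) (yosida_mul hS hl)
  change yosida S l (S y - (l : ℂ) • y) = y at this
  rw [map_sub, map_smul] at this
  exact sub_eq_iff_eq_add.1 this

/-- The resolvent `S (S - l)⁻¹ = (1 - l T)⁻¹` is a contraction. -/
theorem norm_mul_yosida_le (hS : ∀ z, (⟪S z, z⟫_ℂ).re ≤ 0) {l : ℝ} (hl : 0 < l) :
    ‖yosida S l * S‖ ≤ 1 := by
  rw [← (commute_yosida l).eq]
  refine ContinuousLinearMap.opNorm_le_bound _ zero_le_one fun y => ?_
  obtain ⟨z, rfl⟩ := surjective_sub_smul hS hl y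
  have e : yosida S l (S z - (l : ℂ) • z) = z :=
    congrArg (fun L : E →L[ℂ] E => L z) (yosida_mul hS hl)
  change ‖S (yosida S l _)‖ ≤ _
  rw [e, one_mul]
  refine le_of_sq_le_sq ?_ (norm_nonneg _)
  have h := norm_sub_sq (𝕜 := ℂ) (S z) ((l : ℂ) • z)
  rw [inner_smul_right] at h
  change _ = _ - 2 * ((l : ℂ) * ⟪S z, z⟫_ℂ).re + _ at h
  rw [Complex.re_ofReal_mul] at h
  rw [h]
  nlinarith [hS z, sq_nonneg ‖(l : ℂ) • z‖]

/-- An injective dissipative bounded operator has dense range. -/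
theorem dense_range_of_dissipative (hS : ∀ z, (⟪S z, z⟫_ℂ).re ≤ 0)
    (hinj : ∀ z, S z = 0 → z = 0) : Dense (range S) := by
  have hbot : (LinearMap.range (S : E →ₗ[ℂ] E))ᗮ = ⊥ := by
    rw [Submodule.eq_bot_iff]
    intro z hz
    have hz' : ∀ u, ⟪S u, z⟫_ℂ = 0 := fun u => Submodule.mem_orthogonal _ z |>.1 hz _ ⟨u, rfl⟩
    -- `⟪S (z + r u), z + r u⟫ = r ⟪S z, u⟫ + r² ⟪S u, u⟫`; take `u = S z` and `r > 0` small.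
    refine hinj z ?_
    have key : ∀ r : ℝ, r * ‖S z‖ ^ 2 + r ^ 2 * (⟪S (S z), S z⟫_ℂ).re ≤ 0 := by
      intro r
      have h1 := hS (z + (r : ℂ) • S z)
      have h2 : (⟪S z, S z⟫_ℂ).re = ‖S z‖ ^ 2 := inner_self_eq_norm_sq (𝕜 := ℂ) _
      rw [map_add, map_smul, inner_add_left, inner_add_right, inner_add_right, inner_smul_left,
        inner_smul_left, hz', hz', inner_smul_right, inner_smul_right, Complex.conj_ofReal] at h1
      simp only [Complex.add_re, Complex.re_ofReal_mul, mul_zero, zero_add, h2] at h1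
      nlinarith [h1]
    set a := ‖S z‖ ^ 2 with ha
    set b := (⟪S (S z), S z⟫_ℂ).re
    have ha0 : 0 ≤ a := sq_nonneg _
    have hb : b ≤ 0 := hS _
    have hak := key (a / (1 - b))
    have h1b : 0 < 1 - b := by linarith
    have : a = 0 := by
      by_contra hne
      have hpos : 0 < a := lt_of_le_of_ne ha0 (Ne.symm hne)
      have hr : 0 < a / (1 - b) := by positivity
      have h3 : a / (1 - b) * (1 - b) = a := div_mul_cancel₀ _ h1b.ne'
      have h4 : a / (1 - b) * (a + a / (1 - b) * b) ≤ 0 := by linarith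
      have h5 : a + a / (1 - b) * b = a / (1 - b) := by linarith
      rw [h5] at h4
      nlinarith
    exact norm_eq_zero.1 (pow_eq_zero_iff two_ne_zero |>.1 this)
  have := (Submodule.topologicalClosure_eq_top_iff
    (K := LinearMap.range (S : E →ₗ[ℂ] E))).2 hbot
  rw [← Submodule.dense_iff_topologicalClosure_eq_top] at this
  exact this

theorem dense_domain (hS : ∀ z, (⟪S z, z⟫_ℂ).re ≤ 0) (hT : ∀ x y, (x, y) ∈ T.graph ↔ S y = x) :
    Dense (T.domain : Set E) := by
  rw [domain_eq_range hT]
  exact dense_range_of_dissipative hS (apply_eq_zero_of_graph hT)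

/-- The inverse of an everywhere defined dissipative operator is maximal dissipative: a proper
dissipative extension `R` would make `1 - R` non-injective, because `1 - T` is onto. -/
theorem isMaximalDissipative_of_inverse (hS : ∀ z, (⟪S z, z⟫_ℂ).re ≤ 0)
    (hT : ∀ x y, (x, y) ∈ T.graph ↔ S y = x) : IsMaximalDissipative T := by
  have hd : ∀ x : T.domain, S (T x) = x := fun x => (hT _ _).1 (T.mem_graph x)
  have hsurj : ∀ l : ℝ, 0 < l → ∀ y : E, ∃ x : T.domain, (l : ℂ) • (x : E) - T x = y := by
    intro l hl y
    -- With `x = S z` the equation becomes `(S - l⁻¹) z = l⁻¹ y`.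
    obtain ⟨z, hz⟩ := surjective_sub_smul hS (inv_pos.2 hl) ((l : ℂ)⁻¹ • y)
    obtain ⟨x, hx1, hx2⟩ := (LinearPMap.mem_graph_iff T).1 ((hT (S z) z).2 rfl)
    refine ⟨x, ?_⟩
    have hl' : (l : ℂ) ≠ 0 := by exact_mod_cast hl.ne'
    simp only at hx1 hx2
    rw [hx1, hx2]
    have := congrArg ((l : ℂ) • ·) hz
    simpa [smul_sub, smul_smul, hl'] using this
  refine ⟨fun x => ?_, fun R hR hle => ?_, hsurj⟩
  · have := hS (T x)
    rwa [hd, ← inner_conj_symm, Complex.conj_re] at this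
  · refine (LinearPMap.eq_of_le_of_domain_eq hle (le_antisymm hle.1 fun x hx => ?_)).symm
    obtain ⟨x₀, h0⟩ := hsurj 1 one_pos (x - R ⟨x, hx⟩)
    let x₁ : R.domain := ⟨x₀, hle.1 x₀.2⟩
    have h1 : T x₀ = R x₁ := hle.2 rfl
    have h2 : R (⟨x, hx⟩ - x₁) = ((⟨x, hx⟩ - x₁ : R.domain) : E) := by
      rw [LinearPMap.map_sub, ← h1, Submodule.coe_sub]
      change _ = x - (x₀ : E)
      rw [Complex.ofReal_one, one_smul] at h0
      have : R ⟨x, hx⟩ - T x₀ = x - (x - R ⟨x, hx⟩) - T x₀ := by abel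
      rw [this, ← h0]; abel
    have h3 := hR (⟨x, hx⟩ - x₁)
    rw [h2] at h3
    have h4 : ((⟨x, hx⟩ - x₁ : R.domain) : E) = 0 :=
      norm_eq_zero.1 (pow_eq_zero_iff two_ne_zero |>.1
        (le_antisymm ((inner_self_eq_norm_sq (𝕜 := ℂ) _).symm.trans_le h3) (sq_nonneg _)))
    have h5 : x - (x₀ : E) = 0 := h4
    rw [sub_eq_zero.1 h5]
    exact x₀.2

/-- If the real part of the quadratic form of `S` vanishes then `S* = -S` by polarization, and
this passes to the inverse, domains included. -/
theorem isSkewAdjoint_of_inverse (hS : ∀ z, (⟪S z, z⟫_ℂ).re = 0)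
    (hT : ∀ x y, (x, y) ∈ T.graph ↔ S y = x) : IsSkewAdjoint T := by
  have hdense := dense_domain (fun z => (hS z).le) hT
  refine ⟨hdense, ?_⟩
  have hadj : ContinuousLinearMap.adjoint S = -S := by
    have h0 : ((ContinuousLinearMap.adjoint S + S : E →L[ℂ] E) : E →ₗ[ℂ] E) = 0 := by
      rw [← inner_map_self_eq_zero]
      intro z
      have h1 := hS z
      change ⟪ContinuousLinearMap.adjoint S z + S z, z⟫_ℂ = 0
      rw [inner_add_left, ContinuousLinearMap.adjoint_inner_left, ← inner_conj_symm z, add_comm,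
        Complex.add_conj, h1, mul_zero, Complex.ofReal_zero]
    have h1 : ContinuousLinearMap.adjoint S + S = 0 := by
      ext x
      exact congrArg (fun L : E →ₗ[ℂ] E => L x) h0
    exact eq_neg_of_add_eq_zero_left h1
  have hskew : ∀ y z, ⟪S y, z⟫_ℂ = -⟪y, S z⟫_ℂ := fun y z => by
    rw [← ContinuousLinearMap.adjoint_inner_left, hadj]
    simp
  have hd : ∀ x : T.domain, S (T x) = x := fun x => (hT _ _).1 (T.mem_graph x)
  have hle : -T ≤ T.adjoint := by
    refine LinearPMap.IsFormalAdjoint.le_adjoint hdense fun x y => ?_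
    have hy : S (T y) = (y : E) := hd y
    rw [LinearPMap.neg_apply, inner_neg_right, ← hd x, hskew, ← hy, neg_neg]
  refine (LinearPMap.eq_of_le_of_domain_eq hle (le_antisymm hle.1 fun y hy => ?_)).symm
  have h1 : ∀ z, ⟪T.adjoint ⟨y, hy⟩, S z⟫_ℂ = ⟪y, z⟫_ℂ := by
    intro z
    obtain ⟨x, hx1, hx2⟩ := (LinearPMap.mem_graph_iff T).1 ((hT (S z) z).2 rfl)
    simp only at hx1 hx2
    rw [← hx1, LinearPMap.adjoint_isFormalAdjoint hdense ⟨y, hy⟩ x, hx2]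
  have h2 : S (-T.adjoint ⟨y, hy⟩) = y := by
    refine ext_inner_right ℂ fun z => ?_
    rw [hskew, inner_neg_left, neg_neg, h1]
  have : y ∈ T.domain := LinearPMap.mem_domain_of_mem_graph ((hT _ _).2 h2)
  exact this

theorem norm_yosida_apply_le (hS : ∀ z, (⟪S z, z⟫_ℂ).re ≤ 0) {l : ℝ} (hl : 0 < l) (y : E) :
    ‖yosida S l (S y)‖ ≤ ‖y‖ :=
  norm_apply_le_of_norm_le_one (norm_mul_yosida_le hS hl) y

/-- On the domain of `T`, the Yosida approximations converge to `T`. -/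
theorem tendsto_yosida (hS : ∀ z, (⟪S z, z⟫_ℂ).re ≤ 0) (hd : Dense (range S)) {l : ℕ → ℝ}
    (hl : ∀ n, 0 < l n) (hl0 : Tendsto l atTop (𝓝 0)) (y : E) :
    Tendsto (fun n => yosida S (l n) (S y)) atTop (𝓝 y) := by
  refine tendsto_of_dense (F := fun n => yosida S (l n) * S) (U := ContinuousLinearMap.id ℂ E)
    (fun n => norm_mul_yosida_le hS (hl n)) ContinuousLinearMap.norm_id_le hd ?_ y
  rintro _ ⟨z, rfl⟩
  rw [tendsto_iff_norm_sub_tendsto_zero]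
  refine squeeze_zero (g := fun n => l n * ‖z‖) (fun _ => norm_nonneg _) (fun n => ?_)
    (by simpa using hl0.mul_const ‖z‖)
  change ‖yosida S (l n) (S (S z)) - S z‖ ≤ _
  rw [yosida_apply_apply hS (hl n), add_sub_cancel_left, norm_smul, Complex.norm_real,
    Real.norm_of_nonneg (hl n).le]
  exact mul_le_mul_of_nonneg_left (norm_yosida_apply_le hS (hl n) z) (hl n).le

/-- The semigroup is the strong limit of the exponentials of the Yosida approximations. -/
theorem exists_contraction_limit (hS : ∀ z, (⟪S z, z⟫_ℂ).re ≤ 0) (hd : Dense (range S)) {l : ℕ → ℝ}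
    (hl : ∀ n, 0 < l n) (hl0 : Tendsto l atTop (𝓝 0)) {t : ℝ} (ht : 0 ≤ t) :
    ∃ U : E →L[ℂ] E, ‖U‖ ≤ 1 ∧
      ∀ x, Tendsto (fun n => exp (t • yosida S (l n)) x) atTop (𝓝 (U x)) := by
  refine exists_tendsto_of_dense
    (fun n => norm_exp_smul_le_one (yosida_dissipative hS (hl n)) ht) hd ?_
  rintro _ ⟨y, rfl⟩
  have hc := (tendsto_yosida hS hd hl hl0 y).cauchySeq
  rw [Metric.cauchySeq_iff] at hc ⊢
  intro ε hε
  obtain ⟨N, hN⟩ := hc (ε / (t + 1)) (by positivity)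
  refine ⟨N, fun m hm n hn => ?_⟩
  have h1 := norm_exp_smul_sub_le (commute_yosida_yosida (S := S) (l m) (l n))
    (yosida_dissipative hS (hl m)) (yosida_dissipative hS (hl n)) ht (S y)
  have h2 := hN m hm n hn
  rw [dist_eq_norm] at h2 ⊢
  rw [lt_div_iff₀ (by positivity)] at h2
  nlinarith [norm_nonneg (yosida S (l m) (S y) - yosida S (l n) (S y))]

/-- The Hille–Yosida theorem for a dissipative operator with bounded inverse. -/
theorem exists_semigroup_of_inverse (hS : ∀ z, (⟪S z, z⟫_ℂ).re ≤ 0)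
    (hT : ∀ x y, (x, y) ∈ T.graph ↔ S y = x) :
    ∃ U : NNReal → E →L[ℂ] E, IsContractionC0Semigroup U ∧ IsInfinitesimalGenerator T U := by
  have hd : Dense (range S) := dense_range_of_dissipative hS (apply_eq_zero_of_graph hT)
  let l : ℕ → ℝ := fun n => 1 / ((n : ℝ) + 1)
  have hl : ∀ n, 0 < l n := fun n => Nat.one_div_pos_of_nat
  have hl0 : Tendsto l atTop (𝓝 0) := tendsto_one_div_add_atTop_nhds_zero_nat
  choose U hU1 hU using fun t : NNReal => exists_contraction_limit hS hd hl hl0 t.coe_nonneg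
  have hdis : ∀ n z, (⟪yosida S (l n) z, z⟫_ℂ).re ≤ 0 := fun n => yosida_dissipative hS (hl n)
  have hest1 : ∀ (t : NNReal) (y : E), ‖U t (S y) - S y‖ ≤ t * ‖y‖ := by
    intro t y
    refine le_of_tendsto ((hU t (S y)).sub_const (S y)).norm (Eventually.of_forall fun n => ?_)
    exact (norm_exp_smul_sub_self_le (hdis n) t.2 (S y)).trans
      (mul_le_mul_of_nonneg_left (norm_yosida_apply_le hS (hl n) y) t.2)
  have hest2 : ∀ (t : NNReal) (y z : E),
      ‖U t (S y) - S y - (t : ℝ) • y‖ ≤ t * (t * ‖z‖ + 2 * ‖y - S z‖) := by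
    intro t y z
    have hy := tendsto_yosida hS hd hl hl0 y
    refine le_of_tendsto_of_tendsto'
      (((hU t (S y)).sub_const (S y)).sub (hy.const_smul (t : ℝ))).norm
      ((((hy.sub_const (S z)).norm.const_mul 2).const_add ((t : ℝ) * ‖z‖)).const_mul (t : ℝ))
      fun n => ?_
    refine (norm_exp_smul_sub_sub_le (hdis n) t.2 (S y) (S z)).trans ?_
    refine mul_le_mul_of_nonneg_left ?_ t.2
    have := mul_le_mul_of_nonneg_left (norm_yosida_apply_le hS (hl n) z) t.2
    exact add_le_add this le_rfl
  have hgen : ∀ y : E,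
      Tendsto (fun t : NNReal => ((t : ℝ) : ℂ)⁻¹ • (U t (S y) - S y)) (𝓝[>] 0) (𝓝 y) := by
    intro y
    rw [Metric.tendsto_nhds]
    intro ε hε
    obtain ⟨_, ⟨z, rfl⟩, hz⟩ := hd.exists_dist_lt y (ε := ε / 4) (by positivity)
    have h0 : Tendsto (fun t : NNReal => (t : ℝ) * ‖z‖) (𝓝[>] 0) (𝓝 0) := by
      have : Tendsto (fun t : NNReal => (t : ℝ) * ‖z‖) (𝓝 0) (𝓝 (((0 : NNReal) : ℝ) * ‖z‖)) :=
        (Continuous.tendsto (by fun_prop) _)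
      simpa using this.mono_left nhdsWithin_le_nhds
    filter_upwards [h0.eventually (gt_mem_nhds (show 0 < ε / 2 by positivity)),
      self_mem_nhdsWithin] with t ht htpos
    have htp : (0 : ℝ) < t := htpos
    have htc : ((t : ℝ) : ℂ) ≠ 0 := by exact_mod_cast htp.ne'
    have e : ((t : ℝ) : ℂ)⁻¹ • (U t (S y) - S y) - y =
        ((t : ℝ) : ℂ)⁻¹ • (U t (S y) - S y - (t : ℝ) • y) := by
      rw [smul_sub _ _ ((t : ℝ) • y), ← Complex.coe_smul, smul_smul, inv_mul_cancel₀ htc, one_smul]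
    rw [dist_eq_norm] at hz ⊢
    rw [e, norm_smul, norm_inv, Complex.norm_real, Real.norm_of_nonneg htp.le, inv_mul_lt_iff₀ htp]
    refine (hest2 t y z).trans_lt (mul_lt_mul_of_pos_left ?_ htp)
    linarith
  refine ⟨U, ⟨?_, ?_, ?_, hU1⟩, fun x y => ⟨?_, ?_⟩⟩
  · ext x
    refine tendsto_nhds_unique (hU 0 x) ?_
    simp
  · intro s t
    ext x
    refine tendsto_nhds_unique (hU (s + t) x) ?_
    have h1 : Tendsto (fun n => exp ((s : ℝ) • yosida S (l n)) (exp ((t : ℝ) • yosida S (l n)) x))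
        atTop (𝓝 (U s (U t x))) :=
      tendsto_apply_of_norm_le_one (fun n => norm_exp_smul_le_one (hdis n) s.2) (hU t x)
        (hU s (U t x))
    refine h1.congr fun n => ?_
    let _ : NormedAlgebra ℚ (E →L[ℂ] E) := .restrictScalars ℚ ℝ _
    change _ = exp (((s : ℝ) + (t : ℝ)) • yosida S (l n)) x
    rw [add_smul, NormedSpace.exp_add_of_commute
      (((Commute.refl _).smul_left _).smul_right _)]
    rfl
  · refine tendsto_of_dense (U := ContinuousLinearMap.id ℂ E) hU1 ContinuousLinearMap.norm_id_le
      hd ?_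
    rintro _ ⟨y, rfl⟩
    rw [tendsto_iff_norm_sub_tendsto_zero]
    refine squeeze_zero (fun _ => norm_nonneg _) (fun t => hest1 t y) ?_
    have : Tendsto (fun t : NNReal => (t : ℝ) * ‖y‖) (𝓝 0) (𝓝 (((0 : NNReal) : ℝ) * ‖y‖)) :=
      (Continuous.tendsto (by fun_prop) _)
    simpa using this
  · intro hxy
    rw [← (hT x y).1 hxy]
    exact hgen y
  · intro hlim
    -- The generator is dissipative and extends `T`, and `1 - T` is already onto.
    obtain ⟨y₀, hy₀⟩ := surjective_sub_smul hS one_pos (x - y)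
    rw [Complex.ofReal_one, one_smul] at hy₀
    have hdiff : Tendsto (fun t : NNReal => ((t : ℝ) : ℂ)⁻¹ • (U t (x - S y₀) - (x - S y₀)))
        (𝓝[>] 0) (𝓝 (y - y₀)) := by
      refine (hlim.sub (hgen y₀)).congr fun t => ?_
      rw [← smul_sub, map_sub]
      congr 1; abel
    have hxy : x - S y₀ = y - y₀ := by
      have : x = S y₀ - y₀ + y := by rw [hy₀]; abel
      rw [this]; abel
    rw [hxy] at hdiff
    have hre : (⟪y - y₀, y - y₀⟫_ℂ).re ≤ 0 := by
      refine le_of_tendsto ((Complex.continuous_re.tendsto _).comp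
        (hdiff.inner tendsto_const_nhds)) (Eventually.of_forall fun t => ?_)
      have h1 : (⟪U t (y - y₀), y - y₀⟫_ℂ).re ≤ ‖y - y₀‖ ^ 2 := by
        refine (re_inner_le_norm (𝕜 := ℂ) _ _).trans ?_
        rw [sq]
        exact mul_le_mul_of_nonneg_right (norm_apply_le_of_norm_le_one (hU1 t) _) (norm_nonneg _)
      have h2 : (⟪y - y₀, y - y₀⟫_ℂ).re = ‖y - y₀‖ ^ 2 := inner_self_eq_norm_sq (𝕜 := ℂ) _
      rw [Function.comp_apply, inner_smul_left, inner_sub_left, ← Complex.ofReal_inv,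
        Complex.conj_ofReal, Complex.re_ofReal_mul, Complex.sub_re, h2]
      exact mul_nonpos_of_nonneg_of_nonpos (inv_nonneg.2 t.2) (by linarith)
    have h0 : y - y₀ = 0 :=
      norm_eq_zero.1 (pow_eq_zero_iff two_ne_zero |>.1
        (le_antisymm ((inner_self_eq_norm_sq (𝕜 := ℂ) _).symm.trans_le hre) (sq_nonneg _)))
    rw [hT, sub_eq_zero.1 h0]
    rw [h0] at hxy
    exact (sub_eq_zero.1 hxy).symm

end BoundedInverse

/-! ### The integration operator and boundary values -/

/-- The constant function `1` in `L₂(0,1)`. -/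
def one : L2 := Lp.const 2 (volume.restrict (Ioo (0 : ℝ) 1)) 1

theorem const_eq_smul_one (c : ℂ) : Lp.const 2 (volume.restrict (Ioo (0 : ℝ) 1)) c = c • one := by
  refine Lp.ext ?_
  filter_upwards [Lp.coeFn_const 2 (volume.restrict (Ioo (0 : ℝ) 1)) c,
    Lp.coeFn_smul c one, Lp.coeFn_const 2 (volume.restrict (Ioo (0 : ℝ) 1)) (1 : ℂ)]
    with s h1 h2 h3
  rw [h1, h2, Pi.smul_apply, one, h3]
  simp

theorem inner_one_left (g : L2) : ⟪one, g⟫_ℂ = ∫ s in (0 : ℝ)..1, g s := by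
  rw [L2.inner_def, ← setIntegral_eq]
  refine integral_congr_ae ?_
  filter_upwards [Lp.coeFn_const 2 (volume.restrict (Ioo (0 : ℝ) 1)) (1 : ℂ)] with s hs
  rw [one, hs]
  simp

/-- Integration by parts for the integration operator; by density it is enough to check it for
continuous functions. -/
theorem inner_V_right (f g : L2) : ⟪f, V g⟫_ℂ = ⟪f, one⟫_ℂ * ⟪one, g⟫_ℂ - ⟪V f, g⟫_ℂ := by
  have hd := BoundedContinuousFunction.toLp_denseRange ℂ
    (volume.restrict (Ioo (0 : ℝ) 1)) ℂ (p := 2) (by norm_num)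
  refine hd.induction_on₂
    (p := fun f g : L2 => ⟪f, V g⟫_ℂ = ⟪f, one⟫_ℂ * ⟪one, g⟫_ℂ - ⟪V f, g⟫_ℂ)
    (isClosed_eq (by fun_prop) (by fun_prop)) ?_ f g
  intro u v
  have hae : ∀ u : BoundedContinuousFunction ℝ ℂ,
      BoundedContinuousFunction.toLp 2 (volume.restrict (Ioo (0 : ℝ) 1)) ℂ u
        =ᵐ[volume.restrict (Ioo (0 : ℝ) 1)] u := fun u =>
    BoundedContinuousFunction.coeFn_toLp _ _ _ _
  have hV : ∀ u : BoundedContinuousFunction ℝ ℂ,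
      V (BoundedContinuousFunction.toLp 2 (volume.restrict (Ioo (0 : ℝ) 1)) ℂ u)
        =ᵐ[volume.restrict (Ioo (0 : ℝ) 1)] fun s => ∫ r in (0 : ℝ)..s, u r := by
    intro u
    filter_upwards [V_ae (BoundedContinuousFunction.toLp 2 (volume.restrict (Ioo (0 : ℝ) 1)) ℂ u),
      ae_restrict_mem measurableSet_Ioo] with s hs hs'
    rw [hs]
    refine intervalIntegral.integral_congr_ae_restrict ?_
    rw [uIoc_of_le hs'.1.le]
    exact ae_restrict_of_ae_restrict_of_subset (Ioc_subset_Ioo_right hs'.2) (hae u)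
  have hp : ∀ (u : BoundedContinuousFunction ℝ ℂ) s,
      HasDerivAt (fun s => ∫ r in (0 : ℝ)..s, u r) (u s) s := fun u s =>
    u.continuous.integral_hasStrictDerivAt 0 s |>.hasDerivAt
  have hpc : ∀ u : BoundedContinuousFunction ℝ ℂ, Continuous (fun s => ∫ r in (0 : ℝ)..s, u r) :=
    fun u => continuous_iff_continuousAt.2 fun s => (hp u s).continuousAt
  have hone : ∀ u : BoundedContinuousFunction ℝ ℂ,
      ⟪one, BoundedContinuousFunction.toLp 2 (volume.restrict (Ioo (0 : ℝ) 1)) ℂ u⟫_ℂ =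
        ∫ r in (0 : ℝ)..1, u r := by
    intro u
    rw [inner_one_left, ← setIntegral_eq, ← setIntegral_eq]
    exact integral_congr_ae (hae u)
  have e1 : ⟪BoundedContinuousFunction.toLp 2 (volume.restrict (Ioo (0 : ℝ) 1)) ℂ u,
      V (BoundedContinuousFunction.toLp 2 (volume.restrict (Ioo (0 : ℝ) 1)) ℂ v)⟫_ℂ =
      ∫ s in (0 : ℝ)..1, ⟪u s, ∫ r in (0 : ℝ)..s, v r⟫_ℂ := by
    rw [L2.inner_def, ← setIntegral_eq]
    refine integral_congr_ae ?_
    filter_upwards [hae u, hV v] with s h1 h2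
    rw [h1, h2]
  have e2 : ⟪V (BoundedContinuousFunction.toLp 2 (volume.restrict (Ioo (0 : ℝ) 1)) ℂ u),
      BoundedContinuousFunction.toLp 2 (volume.restrict (Ioo (0 : ℝ) 1)) ℂ v⟫_ℂ =
      ∫ s in (0 : ℝ)..1, ⟪∫ r in (0 : ℝ)..s, u r, v s⟫_ℂ := by
    rw [L2.inner_def, ← setIntegral_eq]
    refine integral_congr_ae ?_
    filter_upwards [hV u, hae v] with s h1 h2
    rw [h1, h2]
  rw [← inner_conj_symm _ one, hone, hone, e1, e2, eq_sub_iff_add_eq, add_comm]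
  have c1 : Continuous fun s => ⟪∫ r in (0 : ℝ)..s, u r, v s⟫_ℂ := (hpc u).inner v.continuous
  have c2 : Continuous fun s => ⟪u s, ∫ r in (0 : ℝ)..s, v r⟫_ℂ := u.continuous.inner (hpc v)
  rw [← intervalIntegral.integral_add (c1.intervalIntegrable _ _) (c2.intervalIntegrable _ _),
    intervalIntegral.integral_eq_sub_of_hasDerivAt (fun s _ => (hp u s).inner ℂ (hp v s))
      ((c1.add c2).intervalIntegrable _ _)]
  simp [mul_comm]

theorem adjoint_V (f : L2) : ContinuousLinearMap.adjoint V f = ⟪one, f⟫_ℂ • one - V f := by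
  refine ext_inner_right ℂ fun g => ?_
  rw [ContinuousLinearMap.adjoint_inner_left, inner_V_right, inner_sub_left, inner_smul_left,
    inner_conj_symm]

theorem re_inner_V (g : L2) : (⟪g, V g⟫_ℂ).re = ‖⟪one, g⟫_ℂ‖ ^ 2 / 2 := by
  have h := congrArg Complex.re (inner_V_right g g)
  rw [Complex.sub_re, ← inner_conj_symm (V g), Complex.conj_re, ← inner_conj_symm g one,
    Complex.conj_mul', ← Complex.ofReal_pow, Complex.ofReal_re] at h
  linarith

/-- The primitive of an `L₂` function is Hölder continuous with exponent `1/2`. -/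
theorem norm_primitive_sub_le (g : L2) {s t : ℝ} (hs : s ∈ Icc (0 : ℝ) 1) (ht : t ∈ Icc (0 : ℝ) 1)
    (hst : s ≤ t) :
    ‖(∫ r in (0 : ℝ)..t, g r) - ∫ r in (0 : ℝ)..s, g r‖ ≤ √(t - s) * ‖g‖ := by
  have hμ : volume.restrict (Ioo (0 : ℝ) 1) (Ioo s t) ≠ ⊤ := measure_ne_top _ _
  have hsub : Ioo s t ⊆ Ioo 0 1 := Ioo_subset_Ioo hs.1 ht.2
  have h1 : (∫ r in (0 : ℝ)..t, g r) - ∫ r in (0 : ℝ)..s, g r =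
      ⟪indicatorConstLp 2 measurableSet_Ioo hμ (1 : ℂ), g⟫_ℂ := by
    rw [intervalIntegral.integral_interval_sub_left (intervalIntegrable_coe g (by simp) ht)
      (intervalIntegrable_coe g (by simp) hs), L2.inner_indicatorConstLp_one,
      intervalIntegral.integral_of_le hst, integral_Ioc_eq_integral_Ioo,
      Measure.restrict_restrict measurableSet_Ioo, inter_eq_left.2 hsub]
  rw [h1]
  refine (norm_inner_le_norm _ _).trans (mul_le_mul_of_nonneg_right ?_ (norm_nonneg _))
  rw [norm_indicatorConstLp two_ne_zero ENNReal.ofNat_ne_top, measureReal_def,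
    Measure.restrict_apply measurableSet_Ioo, inter_eq_left.2 hsub, Real.volume_Ioo,
    ENNReal.toReal_ofReal (by linarith), norm_one, one_mul, Real.sqrt_eq_rpow]
  norm_num

/-- The integration operator is compact: it factors through `C[0,1]`, where the image of the unit
ball is bounded and equicontinuous. -/
theorem isCompactOperator_V : IsCompactOperator V := by
  let P : L2 → BoundedContinuousFunction (Icc (0 : ℝ) 1) ℂ := fun g =>
    BoundedContinuousFunction.mkOfCompact
      ⟨fun s => ∫ r in (0 : ℝ)..s, g r, (continuousOn_primitive g).domRestrict⟩
  let ι : BoundedContinuousFunction (Icc (0 : ℝ) 1) ℂ → L2 := fun f =>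
    BoundedContinuousFunction.toLp 2 (volume.restrict (Ioo (0 : ℝ) 1)) ℂ
      (f.compContinuous ⟨projIcc (0 : ℝ) 1 zero_le_one, continuous_projIcc⟩)
  have hι : Continuous ι := (BoundedContinuousFunction.toLp 2 (volume.restrict (Ioo (0 : ℝ) 1))
    ℂ).continuous.comp (BoundedContinuousFunction.continuous_compContinuous _)
  have hιP : ∀ g, ι (P g) = V g := by
    intro g
    refine Lp.ext ?_
    filter_upwards [V_ae g, BoundedContinuousFunction.coeFn_toLp 2
      (volume.restrict (Ioo (0 : ℝ) 1)) ℂ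
      ((P g).compContinuous ⟨projIcc (0 : ℝ) 1 zero_le_one, continuous_projIcc⟩),
      ae_restrict_mem measurableSet_Ioo] with s h1 h2 hs
    rw [h1, h2]
    change ∫ r in (0 : ℝ)..(projIcc (0 : ℝ) 1 zero_le_one s : ℝ), g r = _
    rw [projIcc_of_mem zero_le_one (Ioo_subset_Icc_self hs)]
  let A := P '' Metric.closedBall 0 1
  have hA : IsCompact (closure A) := by
    refine BoundedContinuousFunction.arzela_ascoli (Metric.closedBall (0 : ℂ) 1)
      (isCompact_closedBall _ _) A ?_ ?_
    · rintro _ s ⟨g, hg, rfl⟩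
      rw [mem_closedBall_zero_iff] at hg ⊢
      exact (norm_primitive_le g s.2).trans hg
    · refine Metric.equicontinuous_of_continuity_modulus (fun d => √d) ?_ _ ?_
      · have := Real.continuous_sqrt.tendsto 0
        rwa [Real.sqrt_zero] at this
      · rintro s t ⟨_, g, hg, rfl⟩
        rw [mem_closedBall_zero_iff] at hg
        change dist (∫ r in (0 : ℝ)..s, g r) (∫ r in (0 : ℝ)..t, g r) ≤ √(dist s t)
        rw [Subtype.dist_eq, Real.dist_eq]
        rcases le_total (s : ℝ) t with h | h
        · rw [dist_comm, dist_eq_norm, abs_sub_comm, abs_of_nonneg (sub_nonneg.2 h)]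
          exact (norm_primitive_sub_le g s.2 t.2 h).trans
            (mul_le_of_le_one_right (Real.sqrt_nonneg _) hg)
        · rw [dist_eq_norm, abs_of_nonneg (sub_nonneg.2 h)]
          exact (norm_primitive_sub_le g t.2 s.2 h).trans
            (mul_le_of_le_one_right (Real.sqrt_nonneg _) hg)
  refine (isCompactOperator_iff_image_closedBall_subset_compact
    (V : L2 →ₗ[ℂ] L2) one_pos).2 ⟨ι '' closure A, hA.image hι, ?_⟩
  rintro _ ⟨g, hg, rfl⟩
  exact ⟨P g, subset_closure ⟨g, hg, rfl⟩, hιP g⟩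

theorem trace_V_one (g : L2) : trace 1 (V g) = ⟪one, g⟫_ℂ := by
  rw [(isContRep_V g).trace_eq one_mem_Icc, inner_one_left]

theorem trace_smul_one {a : ℝ} (ha : a ∈ Icc (0 : ℝ) 1) (c : ℂ) : trace a (c • one) = c := by
  rw [← const_eq_smul_one, (isContRep_const c).trace_eq ha]

theorem hasWeakDeriv_V_add_smul_one (g : L2) (c : ℂ) : HasWeakDeriv (V g + c • one) g := by
  have hz : HasWeakDeriv one 0 := by
    intro φ h1 h2 h3
    have e : ∫ s in Ioo (0 : ℝ) 1, deriv φ s • one s = ∫ s in (0 : ℝ)..1, deriv φ s • (1 : ℂ) := by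
      rw [← setIntegral_eq]
      refine integral_congr_ae ?_
      filter_upwards [Lp.coeFn_const 2 (volume.restrict (Ioo (0 : ℝ) 1)) (1 : ℂ)] with s hs
      rw [one, hs, Function.const_apply]
    obtain ⟨p, hp⟩ := exists_inner_repr h1.continuous
    rw [e, hp, inner_zero_right, neg_zero, intervalIntegral.integral_smul_const,
      intervalIntegral.integral_deriv_eq_sub
        (fun s _ => (h1.differentiable (by simp)).differentiableAt)
        ((h1.continuous_deriv (by simp)).intervalIntegrable _ _), (test_zero h3).1,
      (test_zero h3).2, sub_zero, zero_smul]
  have := (hasWeakDeriv_V g).add (hz.smul c)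
  rwa [smul_zero, add_zero] at this

theorem V_add_smul_one_mem {k : ℕ} {g : L2} (hg : g ∈ sobolev k) (c : ℂ) :
    V g + c • one ∈ sobolev (k + 1) := ⟨g, hg, hasWeakDeriv_V_add_smul_one g c⟩

theorem V_mem_sobolev {k : ℕ} {g : L2} (hg : g ∈ sobolev k) : V g ∈ sobolev (k + 1) :=
  ⟨g, hg, hasWeakDeriv_V g⟩

theorem smul_one_mem_sobolev (c : ℂ) : c • one ∈ sobolev 1 := by
  simpa using V_add_smul_one_mem (zero_mem (sobolev 0)) c

theorem trace_zero_V_add_smul_one (g : L2) (c : ℂ) : trace 0 (V g + c • one) = c := by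
  rw [trace_add zero_mem_Icc (V_mem_sobolev (k := 0) trivial) (smul_one_mem_sobolev c), trace_V,
    trace_smul_one zero_mem_Icc, zero_add]

theorem trace_one_V_add_smul_one (g : L2) (c : ℂ) :
    trace 1 (V g + c • one) = ⟪one, g⟫_ℂ + c := by
  rw [trace_add one_mem_Icc (V_mem_sobolev (k := 0) trivial) (smul_one_mem_sobolev c), trace_V_one,
    trace_smul_one one_mem_Icc]

/-- The fundamental theorem of calculus in `W₂¹(0,1)`. -/
theorem eq_V_add_trace {f : L2} (hf : f ∈ sobolev 1) : f = V (D f) + trace 0 f • one := by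
  obtain ⟨c, hc⟩ := (mem_sobolev_succ.1 hf).1.eq_V_add
  rw [const_eq_smul_one] at hc
  have : trace 0 f = c := by rw [hc, trace_zero_V_add_smul_one]
  rw [this, ← hc]

/-- Integration by parts in `W₂¹(0,1)`, with boundary terms. -/
theorem inner_D_add {f g : L2} (hf : f ∈ sobolev 1) (hg : g ∈ sobolev 1) :
    ⟪D f, g⟫_ℂ + ⟪f, D g⟫_ℂ =
      (starRingEnd ℂ) (trace 1 f) * trace 1 g - (starRingEnd ℂ) (trace 0 f) * trace 0 g := by
  have hf' := eq_V_add_trace hf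
  have hg' := eq_V_add_trace hg
  generalize D f = a at *
  generalize D g = b at *
  generalize trace 0 f = α at *
  generalize trace 0 g = β at *
  subst hf' hg'
  rw [trace_one_V_add_smul_one, trace_one_V_add_smul_one, inner_add_left, inner_add_right,
    inner_smul_left, inner_smul_right, inner_V_right, map_add, inner_conj_symm]
  ring

theorem inner_one_one : ⟪one, one⟫_ℂ = 1 := by
  rw [← trace_V_one, ← add_zero (V one), ← zero_smul ℂ one, trace_one_V_add_smul_one, add_zero,
    inner_one_left, ← setIntegral_eq]
  have : ∫ s in Ioo (0 : ℝ) 1, one s = ∫ s in Ioo (0 : ℝ) 1, (1 : ℂ) :=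
    integral_congr_ae (Lp.coeFn_const 2 (volume.restrict (Ioo (0 : ℝ) 1)) (1 : ℂ))
  rw [this]
  simp

theorem isCompactOperator_adjoint_V :
    IsCompactOperator (ContinuousLinearMap.adjoint V : L2 →L[ℂ] L2) := by
  have h : IsCompactOperator (innerSL ℂ one : L2 →L[ℂ] ℂ) :=
    isCompactOperator_of_locallyCompactSpace_dom _
  have e : ⇑(ContinuousLinearMap.adjoint V : L2 →L[ℂ] L2) =
      ContinuousLinearMap.toSpanSingleton ℂ one ∘ (innerSL ℂ one : L2 →L[ℂ] ℂ) - ⇑V :=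
    funext adjoint_V
  rw [e]
  exact (h.clm_comp (ContinuousLinearMap.toSpanSingleton ℂ one)).sub isCompactOperator_V

/-! ### The inverse of `T` -/

namespace EnergySpace

variable {γ η : ℝ} {h : η ^ 2 < γ}

variable (h) in
/-- The bounded operator `(w, v) ↦ w''`. -/
def curvature : EnergySpace h →L[ℂ] L2 :=
  LinearMap.mkContinuous
    { toFun := fun x => D^[2] x.w
      map_add' := DDw_add
      map_smul' := DDw_smul } 1 fun x => by
    have hpos : (0 : ℝ) < γ - η ^ 2 := by linarith
    rw [one_mul]
    refine le_of_sq_le_sq ?_ (norm_nonneg _)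
    rw [norm_sq]
    have := mul_nonneg hpos.le (sq_nonneg ‖D x.w‖)
    change ‖D^[2] x.w‖ ^ 2 ≤ _
    linarith [sq_nonneg ‖x.v‖]

variable (h) in
/-- The bounded operator `(w, v) ↦ w'`. -/
def gradient : EnergySpace h →L[ℂ] L2 :=
  LinearMap.mkContinuous
    { toFun := fun x => D x.w
      map_add' := Dw_add
      map_smul' := Dw_smul } (√(γ - η ^ 2))⁻¹ fun x => by
    have hpos : (0 : ℝ) < γ - η ^ 2 := by linarith
    rw [le_inv_mul_iff₀ (Real.sqrt_pos.2 hpos)]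
    refine le_of_sq_le_sq ?_ (norm_nonneg _)
    rw [norm_sq, mul_pow, Real.sq_sqrt hpos.le]
    change _ * ‖D x.w‖ ^ 2 ≤ _
    linarith [sq_nonneg ‖x.v‖, sq_nonneg ‖D^[2] x.w‖]

variable (h) in
/-- The bounded operator `(w, v) ↦ v`. -/
def velocity : EnergySpace h →L[ℂ] L2 :=
  LinearMap.mkContinuous
    { toFun := fun x => x.v
      map_add' := v_add
      map_smul' := v_smul } 1 fun x => by
    have hpos : (0 : ℝ) < γ - η ^ 2 := by linarith
    rw [one_mul]
    refine le_of_sq_le_sq ?_ (norm_nonneg _)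
    rw [norm_sq]
    have := mul_nonneg hpos.le (sq_nonneg ‖D x.w‖)
    change ‖x.v‖ ^ 2 ≤ _
    linarith [sq_nonneg ‖D^[2] x.w‖]

variable (h) in
/-- The bounded operator `(w, v) ↦ w`, written as the primitive of `w'`, which makes its
compactness apparent. -/
def displacement : EnergySpace h →L[ℂ] L2 := V ∘L gradient h

variable (h) in
/-- The bounded functional `(w, v) ↦ w'(1)`. As `w' = V w'' + w'(0)`, the boundary values are
`w'(0) = ∫₀¹ (w' - V w'')` and `w'(1) = w'(0) + ∫₀¹ w''`. -/
def slope : EnergySpace h →L[ℂ] ℂ :=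
  innerSL ℂ one ∘L (gradient h - V ∘L curvature h + curvature h)

variable (h) in
/-- The embedding `v ↦ (0, v)`. -/
def ofVelocity : L2 →L[ℂ] EnergySpace h :=
  LinearMap.mkContinuous
    { toFun := fun v => mk 0 v (zero_mem _)
      map_add' := fun _ _ => EnergySpace.ext (add_zero (0 : L2)).symm rfl
      map_smul' := fun c _ => EnergySpace.ext (smul_zero (A := L2) c).symm rfl } 1 fun v => by
    have hD : D (0 : L2) = 0 := hasWeakDeriv_zero.D_eq
    rw [one_mul]
    refine le_of_sq_le_sq ?_ (norm_nonneg _)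
    rw [norm_sq]
    simp [hD]

@[simp] theorem curvature_apply (x : EnergySpace h) : curvature h x = D^[2] x.w := rfl
@[simp] theorem gradient_apply (x : EnergySpace h) : gradient h x = D x.w := rfl
@[simp] theorem velocity_apply (x : EnergySpace h) : velocity h x = x.v := rfl

theorem Dw_mem (x : EnergySpace h) : D x.w ∈ sobolev 1 := (mem_sobolev_succ.1 x.w_mem_two).2

theorem w_eq (x : EnergySpace h) : x.w = V (D x.w) := eq_V_of_trace x.w_mem_one x.w_mem.2

theorem Dw_eq (x : EnergySpace h) : D x.w = V (D^[2] x.w) + trace 0 (D x.w) • one :=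
  eq_V_add_trace x.Dw_mem

@[simp] theorem displacement_apply (x : EnergySpace h) : displacement h x = x.w := x.w_eq.symm

@[simp] theorem slope_apply (x : EnergySpace h) : slope h x = trace 1 (D x.w) := by
  have e : slope h x = ⟪one, D x.w - V (D^[2] x.w) + D^[2] x.w⟫_ℂ := rfl
  have hx := x.Dw_eq
  have e1 : D x.w - V (D^[2] x.w) = trace 0 (D x.w) • one := sub_eq_of_eq_add' hx
  rw [e, e1, inner_add_right, inner_smul_right, inner_one_one, mul_one, add_comm]
  conv_rhs => rw [hx]
  rw [trace_one_V_add_smul_one]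

theorem inner_ofVelocity (f : L2) (z : EnergySpace h) : ⟪ofVelocity h f, z⟫_ℂ = ⟪f, z.v⟫_ℂ := by
  have hD : D (0 : L2) = 0 := hasWeakDeriv_zero.D_eq
  have e : ofVelocity h f = mk 0 f (zero_mem _) := rfl
  rw [e, inner_def]
  simp [hD]

/-- Test functions may be prescribed by `φ''` and `φ'(0)`. -/
theorem exists_test (p : L2) (c : ℂ) : ∃ z : EnergySpace h, D^[2] z.w = p ∧
    D z.w = V p + c • one ∧ z.w = V (V p + c • one) ∧ slope h z = ⟪one, p⟫_ℂ + c := by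
  have hq := V_add_smul_one_mem (k := 0) (g := p) trivial c
  let z : EnergySpace h := mk (V (V p + c • one)) 0 ⟨V_mem_sobolev hq, trace_V _⟩
  have h1 : D z.w = V p + c • one := (hasWeakDeriv_V _).D_eq
  have h2 : D^[2] z.w = p := by
    change D (D z.w) = p
    rw [h1, (hasWeakDeriv_V_add_smul_one p c).D_eq]
  exact ⟨z, h2, h1, rfl, by rw [slope_apply, h1, trace_one_V_add_smul_one]⟩

variable (h) in
/-- The inverse of `T`. For `y = (f, g)` it is `(w, f)`, where `w` is the solution of
`∫ w'' φ'' + (γ - η²) ∫ w' φ' = -∫ (g + 2βη f') φ - κ f'(1) φ'(1)` for all `φ ∈ Ŵ₂²(0,1)`. The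
left-hand side is an inner product of `𝕏`, so the solution operator is a sum of adjoints. -/
def inverse (β κ : ℝ) : EnergySpace h →L[ℂ] EnergySpace h :=
  ofVelocity h ∘L displacement h
    - ContinuousLinearMap.adjoint (displacement h) ∘L
      (velocity h + ((2 * β * η : ℝ) : ℂ) • gradient h)
    - (κ : ℂ) • (ContinuousLinearMap.adjoint (slope h) ∘L slope h)

theorem inner_inverse (β κ : ℝ) (y z : EnergySpace h) : ⟪inverse h β κ y, z⟫_ℂ =
    ⟪y.w, z.v⟫_ℂ - ⟪y.v + ((2 * β * η : ℝ) : ℂ) • D y.w, z.w⟫_ℂ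
      - κ * ((starRingEnd ℂ) (trace 1 (D y.w)) * trace 1 (D z.w)) := by
  have e : inverse h β κ y = ofVelocity h (displacement h y)
      - ContinuousLinearMap.adjoint (displacement h) (y.v + ((2 * β * η : ℝ) : ℂ) • D y.w)
      - (κ : ℂ) • ContinuousLinearMap.adjoint (slope h) (slope h y) := rfl
  rw [e, inner_sub_left, inner_sub_left, inner_smul_left, ContinuousLinearMap.adjoint_inner_left,
    ContinuousLinearMap.adjoint_inner_left, inner_ofVelocity, displacement_apply,
    displacement_apply, slope_apply, slope_apply, Complex.conj_ofReal, RCLike.inner_apply']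

/-- Each summand has a factor `V`, `V*` or a functional. -/
theorem isCompactOperator_inverse (β κ : ℝ) : IsCompactOperator (inverse h β κ) := by
  have hd : IsCompactOperator (displacement h) := isCompactOperator_V.comp_clm (gradient h)
  have hd' : IsCompactOperator (ContinuousLinearMap.adjoint (displacement h)) := by
    rw [displacement, ContinuousLinearMap.adjoint_comp]
    exact isCompactOperator_adjoint_V.clm_comp (ContinuousLinearMap.adjoint (gradient h))
  have hs : IsCompactOperator (slope h) :=
    isCompactOperator_of_locallyCompactSpace_dom _
  exact ((hd.clm_comp (ofVelocity h)).sub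
    (hd'.comp_clm (velocity h + ((2 * β * η : ℝ) : ℂ) • gradient h))).sub
      ((hs.clm_comp (ContinuousLinearMap.adjoint (slope h))).smul (κ : ℂ))

/-- The dissipation. The first term is `-βη |w(1)|²`, since `∫₀¹ w' = w(1)`. -/
theorem re_inner_inverse (β κ : ℝ) (y : EnergySpace h) : (⟪inverse h β κ y, y⟫_ℂ).re =
    -(β * η * ‖⟪one, D y.w⟫_ℂ‖ ^ 2) - κ * ‖trace 1 (D y.w)‖ ^ 2 := by
  have h1 : (⟪D y.w, y.w⟫_ℂ).re = ‖⟪one, D y.w⟫_ℂ‖ ^ 2 / 2 := by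
    have := re_inner_V (D y.w)
    rwa [← y.w_eq] at this
  have h2 : (⟪y.w, y.v⟫_ℂ).re = (⟪y.v, y.w⟫_ℂ).re := by
    rw [← inner_conj_symm, Complex.conj_re]
  rw [inner_inverse, inner_add_left, inner_smul_left, Complex.conj_ofReal, Complex.conj_mul',
    Complex.sub_re, Complex.sub_re, Complex.add_re, Complex.re_ofReal_mul, Complex.re_ofReal_mul,
    h1, h2, ← Complex.ofReal_pow, Complex.ofReal_re]
  ring

/-- Green's formula for `w⁗ - (γ - η²) w''` under the boundary conditions of `T`. -/
theorem inner_add_of_mem_domainA {κ : ℝ} {x : EnergySpace h} (hx : x ∈ domainA h κ)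
    (z : EnergySpace h) :
    ⟪D^[2] x.w, D^[2] z.w⟫_ℂ + ((γ - η ^ 2 : ℝ) : ℂ) * ⟪D x.w, D z.w⟫_ℂ =
      ⟪D^[4] x.w - ((γ - η ^ 2 : ℝ) : ℂ) • D^[2] x.w, z.w⟫_ℂ
        - κ * ((starRingEnd ℂ) (trace 1 (D x.v)) * trace 1 (D z.w)) := by
  obtain ⟨hw, -, x1, x2, x3⟩ := hx
  have h3 := inner_D_add (iterate_D_mem (k := 1) (j := 3) hw) z.w_mem_one
  have h2 := inner_D_add
    (iterate_D_mem (k := 1) (j := 2) (sobolev_anti (by norm_num) hw)) z.Dw_mem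
  have h1 := inner_D_add x.Dw_mem z.w_mem_one
  rw [z.w_mem.2, mul_zero, sub_zero] at h1 h3
  rw [x1, map_zero, zero_mul, sub_zero] at h2
  have e4 : D (D^[3] x.w) = D^[4] x.w := (Function.iterate_succ_apply' D 3 x.w).symm
  have e3 : D (D^[2] x.w) = D^[3] x.w := (Function.iterate_succ_apply' D 2 x.w).symm
  have e2 : D (D x.w) = D^[2] x.w := rfl
  have f2 : D (D z.w) = D^[2] z.w := rfl
  rw [e4, sub_eq_zero.1 x3, map_mul, Complex.conj_ofReal] at h3
  rw [e3, f2, eq_neg_of_add_eq_zero_left x2, map_neg, map_mul, Complex.conj_ofReal] at h2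
  rw [e2] at h1
  rw [inner_sub_left, inner_smul_left, Complex.conj_ofReal]
  linear_combination h2 - h3 + ((γ - η ^ 2 : ℝ) : ℂ) * h1

theorem mem_graph_opT_iff {β κ : ℝ} {x y : EnergySpace h} : (x, y) ∈ (opT h β κ).graph ↔
    x ∈ domainA h κ ∧ x.v = y.w ∧
      -D^[4] x.w + ((γ - η ^ 2 : ℝ) : ℂ) • D^[2] x.w + ((-2 * β * η : ℝ) : ℂ) • D x.v = y.v := by
  rw [LinearPMap.mem_graph_iff]
  constructor
  · rintro ⟨⟨x', hx'⟩, rfl, rfl⟩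
    exact ⟨hx'.1, (add_zero (x'.v)).symm, rfl⟩
  · rintro ⟨hx, hw, hv⟩
    refine ⟨⟨x, by rw [opT_domain]; exact hx⟩, rfl, EnergySpace.ext ?_ hv⟩
    exact (add_zero x.v).trans hw

/-- Regularity of the weak solution: the boundary conditions of `T` are the natural ones. -/
theorem mem_domainA_of_weak {κ : ℝ} {x : EnergySpace h} (hv : x.v ∈ sobolevHat 2) {H : L2}
    (hx : ∀ z : EnergySpace h,
      ⟪D^[2] x.w, D^[2] z.w⟫_ℂ + ((γ - η ^ 2 : ℝ) : ℂ) * ⟪D x.w, D z.w⟫_ℂ =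
        -⟪H, z.w⟫_ℂ - κ * ((starRingEnd ℂ) (trace 1 (D x.v)) * trace 1 (D z.w))) :
    x ∈ domainA h κ ∧ D^[4] x.w = ((γ - η ^ 2 : ℝ) : ℂ) • D^[2] x.w - H := by
  set G : ℂ := ((γ - η ^ 2 : ℝ) : ℂ) with hG
  set t := trace 1 (D x.v)
  set a := D^[2] x.w with ha
  set u := D x.w with hu
  have hGc : (starRingEnd ℂ) G = G := Complex.conj_ofReal _
  have test : ∀ (p : L2) (c : ℂ), ⟪a, p⟫_ℂ + G * ⟪u, V p + c • one⟫_ℂ =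
      -⟪H, V (V p + c • one)⟫_ℂ - κ * ((starRingEnd ℂ) t * (⟪one, p⟫_ℂ + c)) := by
    intro p c
    obtain ⟨z, z1, z2, z3, z4⟩ := exists_test (h := h) p c
    have := hx z
    rwa [← slope_apply z, z1, z2, z3, z4] at this
  set k := ContinuousLinearMap.adjoint V H with hk
  have hkV : k = ⟪one, H⟫_ℂ • one - V H := adjoint_V H
  -- The test functions with `φ' = V p` determine `w''`.
  have ha1 : a = -(G • ContinuousLinearMap.adjoint V u + ContinuousLinearMap.adjoint V k
      + ((κ : ℂ) * t) • one) := by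
    refine ext_inner_right ℂ fun p => ?_
    have h1 := test p 0
    rw [zero_smul, add_zero, add_zero] at h1
    rw [inner_neg_left, inner_add_left, inner_add_left, inner_smul_left, inner_smul_left,
      ContinuousLinearMap.adjoint_inner_left, ContinuousLinearMap.adjoint_inner_left, hk,
      ContinuousLinearMap.adjoint_inner_left, map_mul, Complex.conj_ofReal,
      Complex.conj_ofReal]
    linear_combination h1
  -- The test function `φ(s) = s` gives `w''(0) = 0`.
  have hc : G * ⟪one, u⟫_ℂ + ⟪one, k⟫_ℂ + κ * t = 0 := by
    have h1 := test 0 1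
    rw [map_zero, zero_add, one_smul, inner_zero_right, inner_zero_right, zero_add, zero_add,
      ← ContinuousLinearMap.adjoint_inner_left, ← hk] at h1
    have h2 := congrArg (starRingEnd ℂ) h1
    simp only [map_mul, map_sub, map_neg, inner_conj_symm, hGc, Complex.conj_ofReal, map_one,
      Complex.conj_conj] at h2
    linear_combination h2
  have ha2 : a = V (G • u + k) + (0 : ℂ) • one := by
    rw [ha1, adjoint_V, adjoint_V, map_add, map_smul, ← neg_eq_zero.2 hc]
    module
  have hb : G • u + k = V (G • a - H) + (G * trace 0 u + ⟪one, H⟫_ℂ) • one := by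
    have hu' : u = V a + trace 0 u • one := x.Dw_eq
    rw [hkV]
    conv_lhs => rw [hu']
    rw [map_sub, map_smul]
    module
  have hbm : G • u + k ∈ sobolev 1 := by
    rw [hb]; exact V_add_smul_one_mem (k := 0) trivial _
  have ham : a ∈ sobolev 2 := by
    rw [ha2]; exact V_add_smul_one_mem hbm _
  have hDa : D a = G • u + k := by
    rw [ha2]
    exact (hasWeakDeriv_V_add_smul_one _ _).D_eq
  have hDb : D (G • u + k) = G • a - H := by
    conv_lhs => rw [hb]
    exact (hasWeakDeriv_V_add_smul_one _ _).D_eq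
  have hD3 : D^[3] x.w = G • u + k := by
    rw [Function.iterate_succ_apply', ← ha, hDa]
  have hD4 : D^[4] x.w = G • a - H := by
    rw [Function.iterate_succ_apply', hD3, hDb]
  have hum : u ∈ sobolev 3 := mem_sobolev_succ.2 ⟨(mem_sobolev_succ.1 x.Dw_mem).1, ham⟩
  refine ⟨⟨mem_sobolev_succ.2 ⟨(mem_sobolev_succ.1 x.w_mem_one).1, hum⟩, hv, ?_, ?_, ?_⟩, hD4⟩
  · rw [← ha, ha2, trace_zero_V_add_smul_one]
  · rw [← ha, ha2, trace_one_V_add_smul_one, inner_add_right, inner_smul_right]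
    linear_combination hc
  · have hu1 : trace 1 u = ⟪one, a⟫_ℂ + trace 0 u := by
      conv_lhs => rw [show u = V a + trace 0 u • one from x.Dw_eq]
      exact trace_one_V_add_smul_one _ _
    rw [hD3, hb, trace_one_V_add_smul_one, hu1, inner_sub_right, inner_smul_right]
    ring

theorem mem_graph_opT_iff_inverse (β κ : ℝ) (x y : EnergySpace h) :
    (x, y) ∈ (opT h β κ).graph ↔ inverse h β κ y = x := by
  rw [mem_graph_opT_iff]
  constructor
  · rintro ⟨hx, hw, hv⟩
    refine ext_inner_right ℂ fun z => ?_
    -- Substituting `v = f` turns the equation into the weak form that defines the inverse.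
    have hH : D^[4] x.w - ((γ - η ^ 2 : ℝ) : ℂ) • D^[2] x.w =
        -(y.v + ((2 * β * η : ℝ) : ℂ) • D y.w) := by
      rw [← hv, hw]
      push_cast
      module
    rw [inner_inverse, inner_def, inner_add_of_mem_domainA hx, hH, hw, inner_neg_left]
    ring
  · intro hxy
    have hin : ∀ z, ⟪x, z⟫_ℂ = _ := fun z => hxy ▸ inner_inverse β κ y z
    -- Testing with `(0, f)` gives `v`; the remaining tests are the weak form for `w`.
    have hw : x.v = y.w := by
      refine ext_inner_right ℂ fun f => ?_
      have h1 := hin (ofVelocity h f)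
      have hD : D (0 : L2) = 0 := hasWeakDeriv_zero.D_eq
      have ht : trace 1 (0 : L2) = 0 := by simpa using trace_smul_one one_mem_Icc 0
      have e : ofVelocity h f = mk 0 f (zero_mem _) := rfl
      rw [e, inner_def] at h1
      simpa [hD, ht] using h1
    have hwm : x.v ∈ sobolevHat 2 := hw ▸ y.w_mem
    obtain ⟨hx, h4⟩ := mem_domainA_of_weak (κ := κ) (x := x) hwm
      (H := y.v + ((2 * β * η : ℝ) : ℂ) • D y.w) fun z => by
        have h1 := hin z
        rw [inner_def, hw] at h1
        rw [hw]
        linear_combination h1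
    refine ⟨hx, hw, ?_⟩
    rw [h4, hw]
    push_cast
    module

end EnergySpace

end

end FluidTube

theorem proposition2p1 (γ β η κ : ℝ) (hβ₀ : 0 < β) (hβ₁ : β < 1) (hη : 0 ≤ η) (hκ : 0 ≤ κ)
    (h : η ^ 2 < γ) :
    FluidTube.HasCompactInverse (FluidTube.opT h β κ) ∧
    (0 < η → 0 < κ → FluidTube.IsMaximalDissipative (FluidTube.opT h β κ)) ∧
    (η = 0 → κ = 0 → FluidTube.IsSkewAdjoint (FluidTube.opT h β κ)) ∧
    ∃ U : NNReal → FluidTube.EnergySpace h →L[ℂ] FluidTube.EnergySpace h,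
      FluidTube.IsContractionC0Semigroup U ∧
      FluidTube.IsInfinitesimalGenerator (FluidTube.opT h β κ) U := by
  have hgraph := FluidTube.EnergySpace.mem_graph_opT_iff_inverse (h := h) β κ
  have hdis : ∀ z, (⟪FluidTube.EnergySpace.inverse h β κ z, z⟫_ℂ).re ≤ 0 := by
    intro z
    rw [FluidTube.EnergySpace.re_inner_inverse]
    have h1 : 0 ≤ β * η * ‖⟪FluidTube.one, FluidTube.D z.w⟫_ℂ‖ ^ 2 := by positivity
    have h2 : 0 ≤ κ * ‖FluidTube.trace 1 (FluidTube.D z.w)‖ ^ 2 := by positivity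
    linarith
  refine ⟨⟨_, FluidTube.EnergySpace.isCompactOperator_inverse β κ, hgraph⟩,
    fun _ _ => FluidTube.isMaximalDissipative_of_inverse hdis hgraph,
    fun hη₀ hκ₀ => FluidTube.isSkewAdjoint_of_inverse (fun z => ?_) hgraph,
    FluidTube.exists_semigroup_of_inverse hdis hgraph⟩
  simp [FluidTube.EnergySpace.re_inner_inverse, hη₀, hκ₀]
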